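/- Let $K$ be an algebraically closed field of characteristic $0$, let $U=\operatorname{Spec}A$ be a nonsingular affine surface over $K$ with local coordinates $x_1,x_2$ (i.e. $(x_1,x_2)\colon U\to\mathbb A^2$ is étale), let $o\in U$ be a point with $x_1(o)=x_2(o)=0$, and let $T\subseteq\mathbb A^1$ be an open neighbourhood of $0$. *The monster tower.* Let $S(0)=U$ and $\mathcal B(0)=TU$. For $k\ge 1$ let $S(k)=\mathbb P\mathcal B(k-1)$, with projection $\pi_k\colon S(k)\to S(k-1)$, and let $\mathcal B(k)\subset TS(k)$ be the focal bundle, whose fibre at a point $(q,\ell)$ ($\ell$ a line in $\mathcal B(k-1)_q$) is $\{v: d\pi_k(v)\in\ell\}$. *Charts and the points $N$.* For each word $p_1\cdots p_k$ in the letters $1,2$ there are a chart $\mathcal C(p_1\cdots p_k)\subseteq S(k)$ and functions $x_1(p_1\cdots p_k)$, $x_2(p_1\cdots p_k)$ on it. For the empty word these are $U$ and $x_1,x_2$. Write $p'=p_1\cdots p_{k-1}$, $j=p_k$, $\{i,j\}=\{1,2\}$. Then $\mathcal C(p'j)$ consists of the points $(q,\ell)$ with $q\in\mathcal C(p')$ such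 that $dx_j(p')$ does not vanish on $\ell$, and $x_j(p'j)=x_j(p')$, $x_i(p'j)=dx_i(p')/dx_j(p')$. The origin of $\mathcal C(p_1\cdots p_k)$, i.e. the point of this chart lying over $o$ at which all the coordinates $x_i(p_1\cdots p_m)$, $0\le m\le k$, vanish, is denoted $N(p_1\cdots p_k)$. *Prolongation of the nodal curve.* The lift to $S(k)$ of a curve $C$ in $S(k-1)$ is the closure of the set of points $(q,T_qC)$ with $q$ a nonsingular point of $C$. For $t\in T$, $t\ne0$, let $X(k)_t\subset S(k)$ be the $k$-fold iterated lift of the curve $x_1x_2=t$ in $U$. Let $\mathcal X(k)\subset S(k)\times T$ be the closure of $\{(q,t): t\neq 0,\ q\in X(k)_t\}$ (equivalently, with its reduced structure, the unique extension to a flat family over $T$), and let $X(k)_0$ be its fibre over $t=0$. The irreducible components of $X(k)_0$, with their reduced structure, are called the twigs at level $k$. **Theorem.** Let $k\ge1$ and let $p_1\cdots p_k$ be a word in the letters $1,2$. The points $N(p_1\cdots p_k)\in S(k)$ and $N(p_1\cdots p_{k-1})\in S(k-1)$ exist and are unique, and exactly two twigs at level $k$ pass through $N(p_1\cdots p_k)$.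 One of them (the *emergent* twig) is mapped by $\pi_k$ onto the single point $N(p_1\cdots p_{k-1})$. The image under $\pi_k$ of the other one (the *retained* twig) is a twig at level $k-1$, and $\pi_k$ restricts to an isomorphism of varieties from the retained twig onto this image. -/

import Mathlib

open Topology
open scoped LinearAlgebra.Projectivization

universe u v

noncomputable section

namespace Monster

/-! ### Spaces with functions

Classical varieties over `K` are treated as sets of points together with a Zariski topology and
`K`-valued regular functions.  Such a structure is presented by a family `gen` of generating local
functions `(D, f)`: `D` is declared to be open, and `f` to be regular on `D` (the values of `f`
outside `D` are irrelevant).  Regular functions are those which are locally obtained from the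
generators and the constants by sums, products and inverses of nonvanishing functions. -/

/-- A space with `K`-valued functions, presented by generating local functions. -/
structure FunSpace (K : Type u) where
  carrier : Type v
  gen : Set (Set carrier × (carrier → K))

namespace FunSpace

variable {K : Type u} [Field K]

/-- `X.Local D f`: the function `f` on the open set `D` is an expression in the generators, i.e. it
is built from generators and constants by sums and products (on the intersection of the domains)
and by inversion (on the set where the function does not vanish). -/
inductive Local (X : FunSpace.{u, v} K) : Set X.carrier → (X.carrier → K) → Prop
  | gen {D : Set X.carrier} {f : X.carrier → K} : (D, f) ∈ X.gen → Local X D f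
  | const (c : K) : Local X Set.univ (fun _ => c)
  | add {D E : Set X.carrier} {f g : X.carrier → K} :
      Local X D f → Local X E g → Local X (D ∩ E) (fun y => f y + g y)
  | mul {D E : Set X.carrier} {f g : X.carrier → K} :
      Local X D f → Local X E g → Local X (D ∩ E) (fun y => f y * g y)
  | inv {D : Set X.carrier} {f : X.carrier → K} :
      Local X D f → Local X (D ∩ {y | f y ≠ 0}) (fun y => (f y)⁻¹)

/-- The Zariski topology: generated by the domains of all local functions (this includes the sets
where a local function does not vanish). -/
instance (X : FunSpace.{u, v} K) : TopologicalSpace X.carrier :=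
  TopologicalSpace.generateFrom {D | ∃ f, X.Local D f}

/-- The functions which are regular at `x`, i.e. equal to a local function near `x`. Their values
away from `x` are arbitrary; passing to germs at `x` gives the local ring of `X` at `x`. -/
def regAt (X : FunSpace.{u, v} K) (x : X.carrier) : Subalgebra K (X.carrier → K) where
  carrier := {f | ∃ D g, X.Local D g ∧ x ∈ D ∧ ∀ y ∈ D, f y = g y}
  mul_mem' := by
    rintro a b ⟨D, f, hf, hx, h⟩ ⟨E, g, hg, hx', h'⟩
    refine ⟨_, _, hf.mul hg, ⟨hx, hx'⟩, fun y hy => ?_⟩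
    simp [h y hy.1, h' y hy.2]
  add_mem' := by
    rintro a b ⟨D, f, hf, hx, h⟩ ⟨E, g, hg, hx', h'⟩
    refine ⟨_, _, hf.add hg, ⟨hx, hx'⟩, fun y hy => ?_⟩
    simp [h y hy.1, h' y hy.2]
  algebraMap_mem' := fun c => ⟨_, _, Local.const c, Set.mem_univ x, fun _ _ => rfl⟩

/-- Linear functionals on the functions regular at `x`; tangent vectors are the derivations among
them. -/
abbrev Functional (X : FunSpace.{u, v} K) (x : X.carrier) : Type (max u v) :=
  Module.Dual K (X.regAt x)

/-- The Zariski tangent space at `x`: the `K`-valued point derivations. (A point derivation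
automatically depends only on the germ at `x`, since the indicator function of a neighbourhood
of `x` is an idempotent.) -/
def tangent (X : FunSpace.{u, v} K) (x : X.carrier) : Submodule K (X.Functional x) where
  carrier := {D | ∀ f g : X.regAt x, D (f * g) = f.1 x * D g + g.1 x * D f}
  add_mem' := by
    intro a b ha hb f g
    simp only [LinearMap.add_apply, ha f g, hb f g]
    ring
  zero_mem' := by intro f g; simp
  smul_mem' := by
    intro c a ha f g
    simp only [LinearMap.smul_apply, ha f g, smul_eq_mul]
    ring

open Classical in
/-- The derivative `df(w)` of a function `f` in the direction `w` at a point where `f` is regular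
(and `0` otherwise). -/
def dirDeriv {X : FunSpace.{u, v} K} {x : X.carrier} (w : X.Functional x) (f : X.carrier → K) : K :=
  if h : f ∈ X.regAt x then w ⟨f, h⟩ else 0

/-- The tangent space at `x` of a subset `C`: the tangent vectors killing every function that is
regular at `x` and vanishes on `C` near `x`. -/
def tangentTo (X : FunSpace.{u, v} K) (C : Set X.carrier) (x : X.carrier) :
    Submodule K (X.Functional x) where
  carrier := {w | w ∈ X.tangent x ∧
    ∀ f : X.regAt x, (∀ᶠ y in 𝓝[C] x, f.1 y = 0) → w f = 0}
  add_mem' := by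
    rintro a b ⟨ha, ha'⟩ ⟨hb, hb'⟩
    exact ⟨add_mem ha hb, fun f hf => by simp [ha' f hf, hb' f hf]⟩
  zero_mem' := ⟨zero_mem _, fun f _ => by simp⟩
  smul_mem' := by
    rintro c a ⟨ha, ha'⟩
    exact ⟨Submodule.smul_mem _ c ha, fun f hf => by simp [ha' f hf]⟩

/-- The product of `X` with a subset `T` of the affine line. -/
def prodLine (X : FunSpace.{u, v} K) (T : Set K) : FunSpace.{u, max u v} K where
  carrier := X.carrier × T
  gen := {P | ∃ D f, X.Local D f ∧ P = (Prod.fst ⁻¹' D, fun z => f z.1)} ∪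
    {(Set.univ, fun z => (z.2 : K))}

/-- `φ` restricts to a morphism on the subset `Z` (with its reduced induced structure): it is
continuous on `Z`, and it pulls regular functions back to functions on `Z` which are locally
restrictions of regular functions. -/
def IsMorphismOn {X Y : FunSpace.{u, v} K} (φ : X.carrier → Y.carrier) (Z : Set X.carrier) :
    Prop :=
  ContinuousOn φ Z ∧
    ∀ x ∈ Z, ∀ g ∈ Y.regAt (φ x), ∃ h ∈ X.regAt x, ∀ᶠ y in 𝓝[Z] x, g (φ y) = h y

/-- `φ` restricts to an isomorphism from `Z` onto `Z'` (both with the reduced induced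
structure). -/
def IsIsomorphismOn {X Y : FunSpace.{u, v} K} (φ : X.carrier → Y.carrier) (Z : Set X.carrier)
    (Z' : Set Y.carrier) : Prop :=
  IsMorphismOn φ Z ∧ Set.MapsTo φ Z Z' ∧
    ∃ ψ : Y.carrier → X.carrier, IsMorphismOn ψ Z' ∧ Set.MapsTo ψ Z' Z ∧ Set.InvOn ψ φ Z Z'

end FunSpace

open FunSpace

/-! ### Projectivized bundles and the focal bundle -/

/-- A space together with a linear subspace `B x` of each tangent space (a "subbundle" of the
tangent bundle; the ambient type of `B x` consists of functionals, and for all spaces constructed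
below `B x` lies in the tangent space). -/
structure Distribution (K : Type u) [Field K] where
  space : FunSpace.{u, v} K
  B : ∀ x : space.carrier, Submodule K (space.Functional x)

namespace Distribution

variable {K : Type u} [Field K]

/-- The points of the projectivization `ℙ(B)`: pairs of a point `x` and a line in `B x`. -/
abbrev Points (M : Distribution.{u, max u v} K) : Type (max u v) :=
  Σ x : M.space.carrier, ℙ K (M.B x)

/-- A nonzero vector on the line represented by a point of `ℙ(B)`. -/
def dir (M : Distribution.{u, max u v} K) (q : M.Points) : M.space.Functional q.1 :=
  (q.2.rep : M.B q.1)

/-- The line represented by a point of `ℙ(B)`, inside the tangent space. -/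
def line (M : Distribution.{u, max u v} K) (q : M.Points) :
    Submodule K (M.space.Functional q.1) :=
  q.2.submodule.map (M.B q.1).subtype

/-- The function `df/dg` on `ℙ(B)`: the ratio of `df` and `dg` along the line represented by `q`. It
is meaningful where `dg` does not vanish on this line. -/
def slope (M : Distribution.{u, max u v} K) (f g : M.space.carrier → K) (q : M.Points) : K :=
  dirDeriv (M.dir q) f / dirDeriv (M.dir q) g

/-- The total space of the projectivization `ℙ(B)`. Its regular functions are generated by the
pullbacks of regular functions `f`, and by the ratios `df/dg` on the open set where `dg` does not
vanish. -/
def proj (M : Distribution.{u, max u v} K) : FunSpace.{u, max u v} K where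
  carrier := M.Points
  gen := {P | ∃ D f, M.space.Local D f ∧ P = (Sigma.fst ⁻¹' D, fun q => f q.1)} ∪
    {P | ∃ D f E g, M.space.Local D f ∧ M.space.Local E g ∧
      P = ({q | q.1 ∈ D ∧ q.1 ∈ E ∧ dirDeriv (M.dir q) g ≠ 0}, M.slope f g)}

/-- The pullback of a regular function to `ℙ(B)` is regular. -/
theorem comp_fst_mem_regAt (M : Distribution.{u, max u v} K) (q : M.Points)
    (f : M.space.regAt q.1) : (fun r : M.Points => f.1 r.1) ∈ M.proj.regAt q := by
  obtain ⟨D, g, hg, hx, h⟩ := f.2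
  exact ⟨Sigma.fst ⁻¹' D, fun r => g r.1, Local.gen (Or.inl ⟨D, g, hg, rfl⟩), hx,
    fun y hy => h y.1 hy⟩

/-- The derivative `dπ` of the projection `π : ℙ(B) → M` at the point `q`. -/
def dproj (M : Distribution.{u, max u v} K) (q : M.Points) :
    M.proj.Functional q →ₗ[K] M.space.Functional q.1 where
  toFun w :=
    { toFun := fun f => w ⟨fun r : M.Points => f.1 r.1, M.comp_fst_mem_regAt q f⟩
      map_add' := fun f g => by rw [← map_add]; rfl
      map_smul' := fun c f => by rw [RingHom.id_apply, ← map_smul]; rfl }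
  map_add' _ _ := rfl
  map_smul' _ _ := rfl

/-- The projectivization `ℙ(B)` with its focal bundle: a tangent vector at `q` is focal if `dπ`
maps it into the line represented by `q`. -/
def next (M : Distribution.{u, max u v} K) : Distribution.{u, max u v} K where
  space := M.proj
  B q := M.proj.tangent q ⊓ (M.line q).comap (M.dproj q)

/-- The lift (prolongation) of a curve `C` to `ℙ(B)`: take the tangent line of `C` at each
nonsingular point (the tangent space is then one-dimensional), and then the closure. -/
def lift (M : Distribution.{u, max u v} K) (C : Set M.space.carrier) :
    Set M.next.space.carrier :=
  closure {q : M.next.space.carrier | q.1 ∈ C ∧ M.line q = M.space.tangentTo C q.1}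

end Distribution

/-! ### The monster tower over an affine surface -/

section Tower

variable (K : Type u) [Field K] (A : Type v) [CommRing A] [Algebra K A]

/-- The affine variety of `K`-points of the algebra `A`, with the elements of `A` as generating
functions. -/
def affine : FunSpace.{u, max u v} K where
  carrier := A →ₐ[K] K
  gen := {P | ∃ a : A, P = (Set.univ, fun y => y a)}

/-- The monster tower over the affine variety with coordinate ring `A`: the space `S(k)` together
with its focal bundle, starting with the tangent bundle. -/
def tower : ℕ → Distribution.{u, max u v} K
  | 0 => ⟨affine K A, (affine K A).tangent⟩
  | k + 1 => (tower k).next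

/-- The monster space `S(k)` at level `k`. -/
abbrev S (k : ℕ) : FunSpace.{u, max u v} K := (tower K A k).space

variable {K A}

/-- The projection from `S(k+1)` to `S(k)`. -/
def π (k : ℕ) (q : (S K A (k + 1)).carrier) : (S K A k).carrier :=
  Sigma.fst (β := fun y => ℙ K ((tower K A k).B y)) q

/-- The coordinates `x_i(p₁⋯p_k)` on `S(k)` (where `p = p₁⋯p_k` is a word in an alphabet of two
letters, and `x 0`, `x 1` are coordinates on the base): with `j` the last letter of `p` and `p'` the
rest of the word, the coordinate `x_j(p)` is the retained coordinate `x_j(p')`, and for the other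
index `i` it is the new coordinate `d x_i(p') / d x_j(p')`. -/
def coord (x : Fin 2 → A) : ∀ (k : ℕ), (Fin k → Fin 2) → Fin 2 → (S K A k).carrier → K
  | 0, _, i => fun y : A →ₐ[K] K => y (x i)
  | k + 1, p, i =>
    if i = p (Fin.last k) then fun q => coord x k (Fin.init p) i (π k q)
    else (tower K A k).slope (coord x k (Fin.init p) i) (coord x k (Fin.init p) (p (Fin.last k)))

/-- The domain of the chart `C(p₁⋯p_k)`: with `j` the last letter of `p` and `p'` the rest of the
word, it consists of the points over `C(p')` representing a line on which `d x_j(p')` does not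
vanish. -/
def chart (x : Fin 2 → A) : ∀ (k : ℕ), (Fin k → Fin 2) → Set (S K A k).carrier
  | 0, _ => Set.univ
  | k + 1, p => {q | π k q ∈ chart x k (Fin.init p) ∧
      dirDeriv ((tower K A k).dir q) (coord x k (Fin.init p) (p (Fin.last k))) ≠ 0}

/-- `IsNode x o k p q`: the point `q` is the origin `N(p₁⋯p_k)` of the chart `C(p₁⋯p_k)`, i.e. it
lies in this chart and over the point `o` of the base, and all its coordinates vanish. -/
def IsNode (x : Fin 2 → A) (o : A →ₐ[K] K) :
    ∀ (k : ℕ), (Fin k → Fin 2) → (S K A k).carrier → Prop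
  | 0, _, q => q = o
  | k + 1, p, q => IsNode x o k (Fin.init p) (π k q) ∧ q ∈ chart x (k + 1) p ∧
      ∀ i, coord x (k + 1) p i q = 0

/-- The `k`th prolongation of the curve `x₁ x₂ = t`. -/
def X (x : Fin 2 → A) (t : K) : ∀ k : ℕ, Set (S K A k).carrier
  | 0 => {y : A →ₐ[K] K | y (x 0) * y (x 1) = t}
  | k + 1 => (tower K A k).lift (X x t k)

/-- The total space of the family of `k`th prolongations inside `S(k) × T`: the closure (that is,
the flat extension over `t = 0`) of the family of the prolongations for `t ≠ 0`. -/
def family (x : Fin 2 → A) (T : Set K) (k : ℕ) : Set ((S K A k).prodLine T).carrier :=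
  closure {z : ((S K A k).prodLine T).carrier | (z.2 : K) ≠ 0 ∧ z.1 ∈ X x (z.2 : K) k}

/-- The `k`th prolongation of the nodal curve: the central member of the family. -/
def nodal (x : Fin 2 → A) (T : Set K) (k : ℕ) : Set (S K A k).carrier :=
  {q | ∃ h : (0 : K) ∈ T, ((q, ⟨0, h⟩) : (S K A k).carrier × T) ∈ family x T k}

/-- The twigs at level `k`: the irreducible components of the `k`th prolongation of the nodal
curve. -/
def IsTwig (x : Fin 2 → A) (T : Set K) (k : ℕ) (Z : Set (S K A k).carrier) : Prop :=
  Maximal (fun Y : Set (S K A k).carrier => IsIrreducible Y ∧ Y ⊆ nodal x T k) Z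

end Tower

end Monster

end

universe w

noncomputable section

set_option linter.unusedSectionVars false

namespace Monster

namespace FunSpace

variable {K : Type u} [Field K]

theorem Local.isOpen {X : FunSpace.{u, v} K} {D : Set X.carrier} {f : X.carrier → K}
    (h : X.Local D f) : IsOpen D :=
  TopologicalSpace.isOpen_generateFrom_of_mem ⟨f, h⟩

theorem isTopologicalBasis_local (X : FunSpace.{u, v} K) :
    TopologicalSpace.IsTopologicalBasis {D : Set X.carrier | ∃ f, X.Local D f} := by
  have h := TopologicalSpace.isTopologicalBasis_of_subbasis_of_inter
    (r := {D : Set X.carrier | ∃ f, X.Local D f}) rfl ?_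
  · rwa [Set.insert_eq_of_mem] at h
    exact ⟨_, Local.const 0⟩
  · rintro D ⟨f, hf⟩ E ⟨g, hg⟩
    exact ⟨_, hf.add hg⟩

theorem exists_local_of_mem_nhds {X : FunSpace.{u, v} K} {x : X.carrier} {U : Set X.carrier}
    (hU : U ∈ 𝓝 x) : ∃ D f, X.Local D f ∧ x ∈ D ∧ D ⊆ U := by
  obtain ⟨D, ⟨f, hf⟩, hx, hD⟩ := X.isTopologicalBasis_local.mem_nhds_iff.1 hU
  exact ⟨D, f, hf, hx, hD⟩

theorem Local.mem_regAt {X : FunSpace.{u, v} K} {x : X.carrier} {D : Set X.carrier}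
    {f : X.carrier → K} (h : X.Local D f) (hx : x ∈ D) : f ∈ X.regAt x :=
  ⟨D, f, h, hx, fun _ _ => rfl⟩

/-- The restriction of a local function to a neighbourhood of a point. -/
theorem Local.restrict {X : FunSpace.{u, v} K} {x : X.carrier} {D U : Set X.carrier}
    {f : X.carrier → K} (h : X.Local D f) (hx : x ∈ D) (hU : U ∈ 𝓝 x) :
    ∃ E, X.Local E f ∧ x ∈ E ∧ E ⊆ U ∧ E ⊆ D := by
  obtain ⟨E, g, hg, hxE, hE⟩ := exists_local_of_mem_nhds hU
  have := h.add ((Local.const (0 : K)).mul hg)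
  simp only [zero_mul, add_zero, Set.univ_inter] at this
  exact ⟨_, this, ⟨hx, hxE⟩, fun y hy => hE hy.2, fun y hy => hy.1⟩

theorem regAt_congr {X : FunSpace.{u, v} K} {x : X.carrier} {f g : X.carrier → K}
    (hf : f ∈ X.regAt x) (h : ∀ᶠ y in 𝓝 x, f y = g y) : g ∈ X.regAt x := by
  obtain ⟨D, a, ha, hx, hD⟩ := hf
  obtain ⟨E, hE, hxE, hEU, hED⟩ := ha.restrict hx h
  exact ⟨E, a, hE, hxE, fun y hy => by rw [← hD y (hED hy)]; exact (hEU hy).symm⟩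

theorem regAt_inv {X : FunSpace.{u, v} K} {x : X.carrier} {f : X.carrier → K}
    (hf : f ∈ X.regAt x) (h0 : f x ≠ 0) : (fun y => (f y)⁻¹) ∈ X.regAt x := by
  obtain ⟨D, a, ha, hx, hD⟩ := hf
  exact ⟨_, _, ha.inv, ⟨hx, by rwa [Set.mem_ofPred_eq, ← hD x hx]⟩,
    fun y hy => congrArg _ (hD y hy.1)⟩

theorem eventually_ne_zero {X : FunSpace.{u, v} K} {x : X.carrier} {f : X.carrier → K}
    (hf : f ∈ X.regAt x) (h0 : f x ≠ 0) : ∀ᶠ y in 𝓝 x, f y ≠ 0 := by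
  obtain ⟨D, a, ha, hx, hD⟩ := hf
  refine Filter.mem_of_superset (ha.inv.isOpen.mem_nhds ⟨hx, ?_⟩) fun y hy => ?_
  · rwa [Set.mem_ofPred_eq, ← hD x hx]
  · rw [Set.mem_ofPred_eq, hD y hy.1]; exact hy.2

theorem const_mem_regAt {X : FunSpace.{u, v} K} {x : X.carrier} (c : K) :
    (fun _ => c) ∈ X.regAt x := (Local.const c).mem_regAt (Set.mem_univ x)

/-- A tangent vector only depends on germs. -/
theorem tangent_congr {X : FunSpace.{u, v} K} {x : X.carrier} {w : X.Functional x}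
    (hw : w ∈ X.tangent x) {f g : X.regAt x} (h : ∀ᶠ y in 𝓝 x, f.1 y = g.1 y) : w f = w g := by
  classical
  obtain ⟨D, a, ha, hx, hD⟩ := exists_local_of_mem_nhds h
  have he : (fun y => if y ∈ D then (1 : K) else 0) ∈ X.regAt x :=
    regAt_congr (const_mem_regAt (1 : K))
      (Filter.mem_of_superset (ha.isOpen.mem_nhds hx) fun y hy => by simp [hy])
  have h0 : (f - g) * (⟨_, he⟩ : X.regAt x) = 0 := by
    ext y
    by_cases hy : y ∈ D
    · simp [sub_eq_zero.2 (show f.1 y = g.1 y from hD hy)]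
    · simp [hy]
  have h1 := hw (f - g) ⟨_, he⟩
  have h2 : (f - g).1 x = 0 := by simpa using sub_eq_zero.2 (show f.1 x = g.1 x from hD hx)
  rw [h0, map_zero, h2] at h1
  simp only [hx, if_true, zero_mul, one_mul, zero_add] at h1
  exact sub_eq_zero.1 (by rw [← map_sub]; exact h1.symm)

theorem dirDeriv_eq {X : FunSpace.{u, v} K} {x : X.carrier} (w : X.Functional x)
    {f : X.carrier → K} (hf : f ∈ X.regAt x) : dirDeriv w f = w ⟨f, hf⟩ := by
  rw [dirDeriv, dif_pos hf]

theorem dirDeriv_congr {X : FunSpace.{u, v} K} {x : X.carrier} {w : X.Functional x}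
    (hw : w ∈ X.tangent x) {f g : X.carrier → K} (hf : f ∈ X.regAt x)
    (h : ∀ᶠ y in 𝓝 x, f y = g y) : dirDeriv w f = dirDeriv w g := by
  rw [dirDeriv_eq w hf, dirDeriv_eq w (regAt_congr hf h)]
  exact tangent_congr hw h

/-- If the generators have fractional expressions along a map from `K`-points of an algebra, then so
have all local functions. -/
theorem Local.exists_fraction {X : FunSpace.{u, v} K} {R : Type*} [CommRing R] [Algebra K R]
    (Ψ : (R →ₐ[K] K) → X.carrier) (V : Set (R →ₐ[K] K))
    (hgen : ∀ D f, (D, f) ∈ X.gen → ∀ y ∈ V, Ψ y ∈ D →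
      ∃ a b : R, y b ≠ 0 ∧ ∀ z ∈ V, z b ≠ 0 → Ψ z ∈ D ∧ f (Ψ z) = z a / z b)
    {D : Set X.carrier} {f : X.carrier → K} (h : X.Local D f) :
    ∀ y ∈ V, Ψ y ∈ D →
      ∃ a b : R, y b ≠ 0 ∧ ∀ z ∈ V, z b ≠ 0 → Ψ z ∈ D ∧ f (Ψ z) = z a / z b := by
  induction h with
  | gen h => exact hgen _ _ h
  | const c =>
    intro y _ _
    exact ⟨algebraMap K R c, 1, by simp, fun z _ _ => by simp⟩
  | add _ _ ih ih' =>
    rintro y hy ⟨h, h'⟩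
    obtain ⟨a, b, hb, H⟩ := ih y hy h
    obtain ⟨a', b', hb', H'⟩ := ih' y hy h'
    refine ⟨a * b' + a' * b, b * b', by simp [hb, hb'], fun z hz hzb => ?_⟩
    rw [map_mul, mul_ne_zero_iff] at hzb
    obtain ⟨h1, h2⟩ := H z hz hzb.1
    obtain ⟨h1', h2'⟩ := H' z hz hzb.2
    refine ⟨⟨h1, h1'⟩, ?_⟩
    have := hzb.1
    have := hzb.2
    simp only [h2, h2', map_add, map_mul]
    field_simp
  | mul _ _ ih ih' =>
    rintro y hy ⟨h, h'⟩
    obtain ⟨a, b, hb, H⟩ := ih y hy h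
    obtain ⟨a', b', hb', H'⟩ := ih' y hy h'
    refine ⟨a * a', b * b', by simp [hb, hb'], fun z hz hzb => ?_⟩
    rw [map_mul, mul_ne_zero_iff] at hzb
    obtain ⟨h1, h2⟩ := H z hz hzb.1
    obtain ⟨h1', h2'⟩ := H' z hz hzb.2
    refine ⟨⟨h1, h1'⟩, ?_⟩
    simp only [h2, h2', map_mul]
    rw [div_mul_div_comm]
  | inv _ ih =>
    rintro y hy ⟨h, h'⟩
    obtain ⟨a, b, hb, H⟩ := ih y hy h
    have ha : y a ≠ 0 := by
      intro h0
      apply h'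
      rw [(H y hy hb).2, h0, zero_div]
    refine ⟨b * b, a * b, by simp [ha, hb], fun z hz hzb => ?_⟩
    rw [map_mul, mul_ne_zero_iff] at hzb
    obtain ⟨h1, h2⟩ := H z hz hzb.2
    have := hzb.1
    have := hzb.2
    refine ⟨⟨h1, ?_⟩, ?_⟩
    · rw [Set.mem_ofPred_eq, h2]
      exact div_ne_zero hzb.1 hzb.2
    · simp only [h2, map_mul]
      field_simp

end FunSpace

/-! ### Points and derivations of finitely generated algebras -/

section Algebra

variable {K : Type u} [Field K] {R : Type v} [CommRing R] [Algebra K R]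

/-- The Nullstellensatz for the `K`-points of a finitely generated algebra. -/
theorem exists_point_of_notMem_radical [IsAlgClosed K] [Algebra.FiniteType K R] {I : Ideal R}
    {f : R} (hf : f ∉ I.radical) : ∃ y : R →ₐ[K] K, (∀ a ∈ I, y a = 0) ∧ y f ≠ 0 := by
  have : IsJacobsonRing R := isJacobsonRing_of_finiteType (A := K)
  rw [Ideal.radical_eq_jacobson, Ideal.jacobson, Submodule.mem_sInf] at hf
  push Not at hf
  obtain ⟨M, ⟨hIM, hM⟩, hfM⟩ := hf
  let _ : Field (R ⧸ M) := Ideal.Quotient.field M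
  have : Module.Finite K (R ⧸ M) := finite_of_finite_type_of_isJacobsonRing K (R ⧸ M)
  let e := AlgEquiv.ofBijective (Algebra.ofId K (R ⧸ M))
    (IsAlgClosed.algebraMap_bijective_of_isIntegral (k := K))
  refine ⟨(e.symm : (R ⧸ M) →ₐ[K] K).comp (Ideal.Quotient.mkₐ K M), fun a ha => ?_, ?_⟩
  · have : Ideal.Quotient.mkₐ K M a = 0 := Ideal.Quotient.eq_zero_iff_mem.2 (hIM ha)
    rw [AlgHom.comp_apply, this, map_zero]
  · intro h
    exact hfM (Ideal.Quotient.eq_zero_iff_mem.1 ((map_eq_zero_iff _ e.symm.injective).1 h))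

/-- In characteristic zero, the radical of a differential ideal is a differential ideal. -/
theorem derivation_mem_radical [CharZero K] (θ : Derivation K R R) {I : Ideal R}
    (hI : ∀ a ∈ I, θ a ∈ I) {a : R} (ha : a ∈ I.radical) : θ a ∈ I.radical := by
  obtain ⟨n, hn⟩ := ha
  have key : ∀ m l : ℕ, a ^ m * θ a ^ l ∈ I → ∃ l', θ a ^ l' ∈ I := by
    intro m
    induction m with
    | zero => intro l h; exact ⟨l, by simpa using h⟩
    | succ m ih =>
      intro l h
      refine ih (l + 2) ?_
      have h1 := hI _ h
      have h2 : algebraMap K R ((m : K) + 1)⁻¹ * (θ a * θ (a ^ (m + 1) * θ a ^ l) -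
          l * (a ^ (m + 1) * θ a ^ l) * θ (θ a)) ∈ I :=
        I.mul_mem_left _ (I.sub_mem (I.mul_mem_left _ h1)
          (I.mul_mem_right _ (I.mul_mem_left _ h)))
      convert h2 using 1
      have h3 : algebraMap K R ((m : K) + 1)⁻¹ * ((m : R) + 1) = 1 := by
        have : ((m : R) + 1) = algebraMap K R ((m : K) + 1) := by simp
        rw [this, ← map_mul, inv_mul_cancel₀ (Nat.cast_add_one_ne_zero m)]
        exact map_one _
      rcases l with _ | l
      · simp only [Derivation.leibniz, Derivation.leibniz_pow, smul_eq_mul, nsmul_eq_mul,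
          Nat.cast_zero, pow_zero, Nat.add_sub_cancel, Derivation.map_one_eq_zero]
        push_cast
        linear_combination (-(a ^ m * θ a ^ 2)) * h3
      · simp only [Derivation.leibniz, Derivation.leibniz_pow, smul_eq_mul, nsmul_eq_mul,
          Nat.add_sub_cancel]
        push_cast
        linear_combination (-(a ^ m * θ a ^ (l + 3))) * h3
  obtain ⟨l, hl⟩ := key n 0 (by simpa using hn)
  exact ⟨l, hl⟩

/-- If a function vanishes on the zero locus of a differential ideal near `y`, then so does its
derivative at `y`. -/
theorem derivation_apply_eq_zero [IsAlgClosed K] [CharZero K] [Algebra.FiniteType K R]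
    (θ : Derivation K R R) {I : Ideal R} (hI : ∀ a ∈ I, θ a ∈ I) {y : R →ₐ[K] K}
    (hy : ∀ a ∈ I, y a = 0) {f c : R} (hc : y c ≠ 0)
    (h : ∀ z : R →ₐ[K] K, (∀ a ∈ I, z a = 0) → z c ≠ 0 → z f = 0) : y (θ f) = 0 := by
  have hrad : ∀ a ∈ I.radical, y a = 0 := by
    rintro a ⟨n, hn⟩
    have := hy _ hn
    rw [map_pow] at this
    exact eq_zero_of_pow_eq_zero this
  have h1 : c * f ∈ I.radical := by
    by_contra h0
    obtain ⟨z, hz, hz'⟩ := exists_point_of_notMem_radical (K := K) h0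
    rw [map_mul, mul_ne_zero_iff] at hz'
    exact hz'.2 (h z hz hz'.1)
  have h2 := hrad _ (derivation_mem_radical θ hI h1)
  rw [Derivation.leibniz, map_add, smul_eq_mul, smul_eq_mul, map_mul, map_mul, h y hy hc,
    zero_mul, add_zero] at h2
  exact (mul_eq_zero.1 h2).resolve_left hc

/-- A function with derivative `1` is a nonzerodivisor modulo a radical differential ideal. -/
theorem mem_radical_of_mul_mem [CharZero K] (η : Derivation K R R) {I : Ideal R}
    (hI : ∀ a ∈ I, η a ∈ I) {x g : R} (hx : η x = 1) (h : g * x ∈ I.radical) :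
    g ∈ I.radical := by
  have h1 := derivation_mem_radical η hI h
  rw [Derivation.leibniz, hx, smul_eq_mul, smul_eq_mul, mul_one] at h1
  have h2 : g ^ 2 ∈ I.radical := by
    have := I.radical.sub_mem (I.radical.mul_mem_left g h1) (I.radical.mul_mem_left (η g) h)
    convert this using 1
    ring
  exact Ideal.radical_isRadical I ⟨2, h2⟩

/-- In characteristic zero, the minimal primes of a differential ideal are differential. -/
theorem derivation_mem_minimalPrime [CharZero K] (θ : Derivation K R R) {I P : Ideal R}
    (hI : ∀ a ∈ I, θ a ∈ I) (hP : P ∈ I.minimalPrimes) {f : R} (hf : f ∈ P) : θ f ∈ P := by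
  have hprime : P.IsPrime := hP.1.1
  obtain ⟨s, hs, n, hn⟩ : ∃ s ∉ P, ∃ n : ℕ, s * f ^ n ∈ I := by
    by_contra! h
    obtain ⟨Q, hQ, hIQ, hdis⟩ := Ideal.exists_le_prime_disjoint I
      (P.primeCompl ⊔ Submonoid.powers f) (by
        rw [Set.disjoint_left]
        intro a ha ha'
        obtain ⟨s, hs, t, ⟨n, rfl⟩, rfl⟩ := Submonoid.mem_sup.1 ha'
        exact h s hs n ha)
    rw [Set.disjoint_left] at hdis
    have hQP : Q ≤ P := fun a ha => by
      by_contra h'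
      exact hdis ha (Submonoid.mem_sup_left (show a ∈ P.primeCompl from h'))
    exact hdis (hP.2 ⟨hQ, hIQ⟩ hQP hf) (Submonoid.mem_sup_right (Submonoid.mem_powers f))
  have h1 : s * f ∈ I.radical := by
    refine ⟨n + 1, ?_⟩
    rw [mul_pow, pow_succ s, pow_succ f, show s ^ n * s * (f ^ n * f) = (s ^ n * f) * (s * f ^ n) by
      ring]
    exact I.mul_mem_left _ hn
  have hle : I.radical ≤ P := hprime.radical_le_iff.2 hP.1.2
  have h2 := hle (derivation_mem_radical θ hI h1)
  rw [Derivation.leibniz, smul_eq_mul, smul_eq_mul] at h2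
  have h3 : s * θ f ∈ P := by
    have := P.sub_mem h2 (P.mul_mem_right (θ s) hf)
    simpa using this
  exact (hprime.mem_or_mem h3).resolve_left hs

end Algebra

section Etale

variable {K : Type u} [Field K] {A : Type v} [CommRing A] [Algebra K A]

theorem exists_dual_derivations (x : Fin 2 → A)
    (hx : (MvPolynomial.aeval x : MvPolynomial (Fin 2) K →ₐ[K] A).toRingHom.Etale) :
    ∃ δ : Fin 2 → Derivation K A A, (∀ a b, δ a (x b) = if a = b then 1 else 0) ∧
      ∀ (y : A →ₐ[K] K) (d : A →ₗ[K] K), (∀ a b, d (a * b) = y a * d b + y b * d a) →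
        ∀ a, d a = ∑ b, d (x b) * y (δ b a) := by
  let P := MvPolynomial (Fin 2) K
  let _ : Algebra P A := (MvPolynomial.aeval x : P →ₐ[K] A).toRingHom.toAlgebra
  have : IsScalarTower K P A := IsScalarTower.of_algebraMap_eq'
    (AlgHom.comp_algebraMap (MvPolynomial.aeval x : P →ₐ[K] A)).symm
  have : Algebra.Etale P A := hx
  have hX : ∀ b, algebraMap P A (MvPolynomial.X b) = x b := fun b => MvPolynomial.aeval_X x b
  let e := KaehlerDifferential.tensorKaehlerEquivOfFormallyEtale K P A
  let δ : Fin 2 → Derivation K A A := fun a =>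
    (((MvPolynomial.mkDerivation K (fun b => if a = b then (1 : A) else 0) :
      Derivation K P A).liftKaehlerDifferential.liftBaseChange A).comp
        e.symm.toLinearMap).compDer (KaehlerDifferential.D K A)
  have hδ : ∀ a b, δ a (x b) = if a = b then 1 else 0 := by
    intro a b
    have h := KaehlerDifferential.tensorKaehlerEquivOfFormallyEtale_symm_D_algebraMap K P A
      (MvPolynomial.X b)
    rw [hX b] at h
    change (LinearMap.liftBaseChange A _) (e.symm (KaehlerDifferential.D K A (x b))) = _
    rw [show e.symm _ = _ from h]
    rw [LinearMap.liftBaseChange_tmul, one_smul]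
    exact (Derivation.liftKaehlerDifferential_comp_D _ _).trans (MvPolynomial.mkDerivation_X _ _ _)
  refine ⟨δ, hδ, fun y d hd a => ?_⟩
  let _ : Module A K := Module.compHom K y.toRingHom
  have hsmul : ∀ (a : A) (c : K), a • c = y a * c := fun _ _ => rfl
  have : IsScalarTower K A K := ⟨fun c a k => by simp [hsmul, mul_assoc]⟩
  let _ : Module P K := Module.compHom K (algebraMap P A)
  have hsmul' : ∀ (p : P) (c : K), p • c = y (algebraMap P A p) * c := fun _ _ => rfl
  have : IsScalarTower P A K := ⟨fun p a k => by
    simp [hsmul, hsmul', Algebra.smul_def, mul_assoc]⟩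
  have : IsScalarTower K P K := ⟨fun c p k => by
    rw [hsmul', hsmul', Algebra.smul_def, map_mul, map_mul, ← IsScalarTower.algebraMap_apply]
    simp [mul_assoc]⟩
  let d' : Derivation K A K :=
    { toLinearMap := d - ∑ b, d (x b) • (y.toLinearMap.comp (δ b).toLinearMap)
      map_one_eq_zero' := by
        have := hd 1 1
        simp at this
        simp [this]
      leibniz' := fun a b => by
        simp [hsmul, hd]
        ring }
  have hd' : ∀ a, d' a = d a - ∑ b, d (x b) * y (δ b a) := fun a => by
    change (d - ∑ b, d (x b) • (y.toLinearMap.comp (δ b).toLinearMap)) a = _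
    simp
  suffices d' = 0 by
    have h := hd' a
    rw [this] at h
    exact (sub_eq_zero.1 h.symm)
  have hP : d'.compAlgebraMap P = 0 := by
    refine MvPolynomial.derivation_ext fun b => ?_
    change d' (algebraMap P A (MvPolynomial.X b)) = 0
    rw [hX, hd']
    simp [hδ]
  have hP' : ∀ p : P, d' (algebraMap P A p) = 0 := fun p => DFunLike.congr_fun hP p
  let d'' : Derivation P A K :=
    { toFun := d'
      map_add' := d'.map_add
      map_smul' := fun p a => by
        rw [Algebra.smul_def, d'.leibniz, hP', smul_zero, add_zero, algebraMap_smul]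
        rfl
      map_one_eq_zero' := d'.map_one_eq_zero
      leibniz' := d'.leibniz }
  have h0 : d'' = 0 := by
    rw [← d''.liftKaehlerDifferential_comp, show d''.liftKaehlerDifferential = 0 from by
      refine LinearMap.ext fun ω => ?_
      rw [Subsingleton.elim ω 0, map_zero, map_zero]]
    ext; rfl
  ext a
  exact DFunLike.congr_fun h0 a

end Etale

open FunSpace

/-- A chart of a space: an open embedding of the set of `K`-points of a finitely generated algebra
`R`, which identifies local functions with fractions. -/
structure AffineChart {K : Type u} [Field K] (S : FunSpace.{u, max u v} K) where
  R : Type v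
  [commRing : CommRing R]
  [algebra : Algebra K R]
  [finiteType : Algebra.FiniteType K R]
  Θ : (R →ₐ[K] K) → S.carrier
  injective : Function.Injective Θ
  isOpen_range : IsOpen (Set.range Θ)
  ext_mem : ∀ a y, Function.extend Θ (fun z => z a) 0 ∈ S.regAt (Θ y)
  exists_fraction : ∀ {D f}, S.Local D f → ∀ y, Θ y ∈ D →
    ∃ a b : R, y b ≠ 0 ∧ ∀ z, z b ≠ 0 → Θ z ∈ D ∧ f (Θ z) = z a / z b

namespace AffineChart

attribute [instance] AffineChart.commRing AffineChart.algebra AffineChart.finiteType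

variable {K : Type u} [Field K] {S : FunSpace.{u, max u v} K} (Φ : AffineChart.{u, v} S)

/-- The function on the whole space extending a function on a chart by zero. -/
def ext (a : Φ.R) : S.carrier → K := Function.extend Φ.Θ (fun z => z a) 0

@[simp] theorem ext_apply (a : Φ.R) (y : Φ.R →ₐ[K] K) : Φ.ext a (Φ.Θ y) = y a :=
  Φ.injective.extend_apply _ _ _

theorem ext_of_notMem (a : Φ.R) {q : S.carrier} (hq : q ∉ Set.range Φ.Θ) : Φ.ext a q = 0 :=
  Function.extend_apply' _ _ _ hq

theorem ext_mem_regAt (a : Φ.R) (y : Φ.R →ₐ[K] K) : Φ.ext a ∈ S.regAt (Φ.Θ y) :=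
  Φ.ext_mem a y

/-- Elements of the algebra of a chart as regular functions at a point. -/
def reg (y : Φ.R →ₐ[K] K) : Φ.R →ₗ[K] S.regAt (Φ.Θ y) where
  toFun a := ⟨Φ.ext a, Φ.ext_mem a y⟩
  map_add' a b := by
    ext q
    by_cases hq : q ∈ Set.range Φ.Θ
    · obtain ⟨z, rfl⟩ := hq
      simp
    · simp [Φ.ext_of_notMem _ hq]
  map_smul' c a := by
    ext q
    by_cases hq : q ∈ Set.range Φ.Θ
    · obtain ⟨z, rfl⟩ := hq
      simp
    · simp [Φ.ext_of_notMem _ hq]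

@[simp] theorem reg_val (y : Φ.R →ₐ[K] K) (a : Φ.R) : (Φ.reg y a).1 = Φ.ext a := rfl

theorem reg_mul (y : Φ.R →ₐ[K] K) (a b : Φ.R) : Φ.reg y (a * b) = Φ.reg y a * Φ.reg y b := by
  ext q
  by_cases hq : q ∈ Set.range Φ.Θ
  · obtain ⟨z, rfl⟩ := hq
    simp
  · simp [Φ.ext_of_notMem _ hq]

variable {Φ} {y : Φ.R →ₐ[K] K}

theorem eventually_of_forall {p : S.carrier → Prop} {b : Φ.R} (hb : y b ≠ 0)
    (h : ∀ z : Φ.R →ₐ[K] K, z b ≠ 0 → p (Φ.Θ z)) : ∀ᶠ q in 𝓝 (Φ.Θ y), p q := by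
  filter_upwards [Φ.isOpen_range.mem_nhds ⟨y, rfl⟩,
    eventually_ne_zero (Φ.ext_mem_regAt b y) (by simpa using hb)]
  rintro _ ⟨z, rfl⟩ hz
  exact h z (by simpa using hz)

theorem exists_of_eventually {p : S.carrier → Prop} (h : ∀ᶠ q in 𝓝 (Φ.Θ y), p q) :
    ∃ b : Φ.R, y b ≠ 0 ∧ ∀ z : Φ.R →ₐ[K] K, z b ≠ 0 → p (Φ.Θ z) := by
  obtain ⟨D, f, hf, hy, hD⟩ := exists_local_of_mem_nhds h
  obtain ⟨a, b, hb, H⟩ := Φ.exists_fraction hf y hy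
  exact ⟨b, hb, fun z hz => hD (H z hz).1⟩

theorem exists_fraction_of_mem_regAt {f : S.carrier → K}
    (hf : f ∈ S.regAt (Φ.Θ y)) :
    ∃ a b : Φ.R, y b ≠ 0 ∧ ∀ z : Φ.R →ₐ[K] K, z b ≠ 0 → f (Φ.Θ z) = z a / z b := by
  obtain ⟨D, g, hg, hy, hD⟩ := hf
  obtain ⟨a, b, hb, H⟩ := Φ.exists_fraction hg y hy
  exact ⟨a, b, hb, fun z hz => by rw [hD _ (H z hz).1, (H z hz).2]⟩

theorem pull_mul {w : S.Functional (Φ.Θ y)} (hw : w ∈ S.tangent (Φ.Θ y)) (a b : Φ.R) :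
    w (Φ.reg y (a * b)) = y a * w (Φ.reg y b) + y b * w (Φ.reg y a) := by
  rw [reg_mul, hw]
  simp

theorem apply_of_fraction {w : S.Functional (Φ.Θ y)} (hw : w ∈ S.tangent (Φ.Θ y))
    (f : S.regAt (Φ.Θ y)) {a b : Φ.R} (hb : y b ≠ 0)
    (h : ∀ z : Φ.R →ₐ[K] K, z b ≠ 0 → f.1 (Φ.Θ z) = z a / z b) :
    w f = (y b * w (Φ.reg y a) - y a * w (Φ.reg y b)) / y b ^ 2 := by
  have h1 : w (f * Φ.reg y b) = w (Φ.reg y a) := by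
    refine tangent_congr hw (eventually_of_forall hb fun z hz => ?_)
    simp only [MulMemClass.coe_mul, Pi.mul_apply, reg_val, ext_apply, h z hz]
    field_simp
  rw [hw, reg_val, ext_apply, h y hb] at h1
  rw [← h1]
  field_simp
  ring

theorem tangent_ext {w w' : S.Functional (Φ.Θ y)} (hw : w ∈ S.tangent (Φ.Θ y))
    (hw' : w' ∈ S.tangent (Φ.Θ y)) (h : ∀ a, w (Φ.reg y a) = w' (Φ.reg y a)) : w = w' := by
  ext f
  obtain ⟨a, b, hb, H⟩ := exists_fraction_of_mem_regAt f.2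
  rw [apply_of_fraction hw f hb H, apply_of_fraction hw' f hb H, h, h]

section

variable [IsAlgClosed K] [CharZero K]

theorem exists_tangent (y : Φ.R →ₐ[K] K) (θ : Derivation K Φ.R Φ.R) :
    ∃ w ∈ S.tangent (Φ.Θ y), ∀ a, w (Φ.reg y a) = y (θ a) := by
  let F : Φ.R → Φ.R → K := fun a b => (y b * y (θ a) - y a * y (θ b)) / y b ^ 2
  have hF : ∀ {f : S.carrier → K} {a b a' b' : Φ.R}, y b ≠ 0 → y b' ≠ 0 →
      (∀ z : Φ.R →ₐ[K] K, z b ≠ 0 → f (Φ.Θ z) = z a / z b) →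
      (∀ z : Φ.R →ₐ[K] K, z b' ≠ 0 → f (Φ.Θ z) = z a' / z b') → F a b = F a' b' := by
    intro f a b a' b' hb hb' h h'
    have hv : ∀ z : Φ.R →ₐ[K] K, (∀ c ∈ (⊥ : Ideal Φ.R), z c = 0) → z (b * b') ≠ 0 →
        z (a * b' - a' * b) = 0 := by
      intro z _ hz
      rw [map_mul, mul_ne_zero_iff] at hz
      have h1 := (h z hz.1).symm.trans (h' z hz.2)
      rw [div_eq_div_iff hz.1 hz.2] at h1
      simp [h1]
    have h1 := derivation_apply_eq_zero θ (I := ⊥) (by simp) (y := y) (by simp)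
      (by simp [hb, hb']) hv
    have h2 := hv y (by simp) (by simp [hb, hb'])
    simp only [map_sub, Derivation.leibniz, smul_eq_mul, map_add, map_mul] at h1 h2
    simp only [F]
    field_simp
    linear_combination (y b * y b') * h1 - (y b * y (θ b') + y b' * y (θ b)) * h2
  choose num den hden hfrac using
    fun f : S.regAt (Φ.Θ y) => exists_fraction_of_mem_regAt f.2
  let w : S.Functional (Φ.Θ y) :=
    { toFun := fun f => F (num f) (den f)
      map_add' := fun f g => by
        rw [hF (hden _) (a' := num f * den g + num g * den f) (b' := den f * den g)
          (by simp [hden]) (hfrac _) fun z hz => ?_]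
        · have := hden f
          have := hden g
          simp only [F, map_add, map_mul, Derivation.leibniz, smul_eq_mul]
          field_simp
          ring
        · rw [map_mul, mul_ne_zero_iff] at hz
          have h1 := hz.1
          have h2 := hz.2
          simp only [AddMemClass.coe_add, Pi.add_apply, hfrac f z hz.1, hfrac g z hz.2, map_add,
            map_mul]
          field_simp
      map_smul' := fun c f => by
        rw [hF (hden _) (a' := c • num f) (b' := den f) (hden f) (hfrac _) fun z hz => ?_]
        · simp only [F, Derivation.map_smul, map_smul, smul_eq_mul, RingHom.id_apply]
          ring
        · simp [hfrac f z hz, mul_div_assoc] }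
  have hw : ∀ f, w f = F (num f) (den f) := fun _ => rfl
  refine ⟨w, fun f g => ?_, fun a => ?_⟩
  · rw [hw, hw, hw, hF (hden _) (a' := num f * num g) (b' := den f * den g)
      (by simp [hden]) (hfrac _) fun z hz => ?_]
    · have := hden f
      have := hden g
      simp only [F, map_mul, Derivation.leibniz, smul_eq_mul, hfrac f y (hden f),
        hfrac g y (hden g), map_add]
      field_simp
      ring
    · rw [map_mul, mul_ne_zero_iff] at hz
      simp only [MulMemClass.coe_mul, Pi.mul_apply, hfrac f z hz.1, hfrac g z hz.2, map_mul]
      rw [div_mul_div_comm]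
  · rw [hw, hF (hden _) (a' := a) (b' := 1) (by simp) (hfrac _) fun z hz => by simp]
    simp [F]

end

end AffineChart

/-- A chart of a space with a rank two distribution: a chart of the space with two coordinates whose
differentials form a frame dual to derivations spanning the distribution. -/
structure Chart {K : Type u} [Field K] (M : Distribution.{u, max u v} K) extends
    AffineChart.{u, v} M.space where
  X : Fin 2 → R
  δ : Fin 2 → Derivation K R R
  δ_X : ∀ a b, δ a (X b) = if a = b then 1 else 0
  B_le : ∀ q, M.B q ≤ M.space.tangent q
  mem_B_iff' : ∀ y, ∀ w ∈ M.space.tangent (Θ y), w ∈ M.B (Θ y) ↔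
    ∀ a, w (toAffineChart.reg y a) = ∑ b, w (toAffineChart.reg y (X b)) * y (δ b a)

namespace Chart

open AffineChart

variable {K : Type u} [Field K] {M : Distribution.{u, max u v} K} {Φ : Chart.{u, v} M}
  {y : Φ.R →ₐ[K] K}

theorem mem_B_iff {w : M.space.Functional (Φ.Θ y)} (hw : w ∈ M.space.tangent (Φ.Θ y)) :
    w ∈ M.B (Φ.Θ y) ↔
      ∀ a, w (Φ.reg y a) = ∑ b, w (Φ.reg y (Φ.X b)) * y (Φ.δ b a) := Φ.mem_B_iff' y w hw

/-- Two vectors of the distribution with the same coordinates are equal. -/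
theorem B_ext {w w' : M.space.Functional (Φ.Θ y)} (hw : w ∈ M.B (Φ.Θ y)) (hw' : w' ∈ M.B (Φ.Θ y))
    (h : ∀ b, w (Φ.reg y (Φ.X b)) = w' (Φ.reg y (Φ.X b))) : w = w' := by
  have ht := Φ.B_le _ hw
  have ht' := Φ.B_le _ hw'
  refine tangent_ext ht ht' fun a => ?_
  rw [(mem_B_iff ht).1 hw, (mem_B_iff ht').1 hw']
  simp only [h]

/-- Vectors of the distribution with prescribed coordinates. -/
theorem exists_mem_B [IsAlgClosed K] [CharZero K] (y : Φ.R →ₐ[K] K) (c : Fin 2 → K) :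
    ∃ w ∈ M.B (Φ.Θ y), ∀ a, w (Φ.reg y a) = ∑ b, c b * y (Φ.δ b a) := by
  obtain ⟨w, hw, h⟩ := exists_tangent y (∑ b, c b • Φ.δ b)
  have h' : ∀ a, w (Φ.reg y a) = ∑ b, c b * y (Φ.δ b a) := fun a => by
    rw [h]
    simp
  refine ⟨w, (mem_B_iff hw).2 fun a => ?_, h'⟩
  simp only [h', Φ.δ_X]
  simp

end Chart

/-! ### Polynomial extensions -/

section Polynomial

variable {K : Type u} [Field K] {R : Type v} [CommRing R] [Algebra K R]

/-- The derivation of a polynomial ring acting on the coefficients. -/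
def coeffDer (d : Derivation K R R) : Derivation K (Polynomial R) (Polynomial R) :=
  PolynomialModule.equivPolynomialSelf.compDer d.mapCoeffs

@[simp] theorem coeffDer_C (d : Derivation K R R) (a : R) :
    coeffDer d (Polynomial.C a) = Polynomial.C (d a) := by
  change PolynomialModule.equivPolynomialSelf (d.mapCoeffs (Polynomial.C a)) = _
  simp

@[simp] theorem coeffDer_X (d : Derivation K R R) : coeffDer d Polynomial.X = 0 := by
  change PolynomialModule.equivPolynomialSelf (d.mapCoeffs Polynomial.X) = _
  simp

/-- The derivation with respect to the variable of a polynomial ring. -/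
def varDer : Derivation K (Polynomial R) (Polynomial R) :=
  (Polynomial.derivative' (R := R)).restrictScalars K

@[simp] theorem varDer_C (a : R) : varDer (K := K) (Polynomial.C a) = 0 := by
  change Polynomial.derivative (Polynomial.C a) = 0
  simp

@[simp] theorem varDer_X : varDer (K := K) (Polynomial.X : Polynomial R) = 1 := by
  change Polynomial.derivative Polynomial.X = 1
  simp

/-- The point of `R[X]` over a point of `R` with a given value of the variable. -/
def extPt (y : R →ₐ[K] K) (c : K) : Polynomial R →ₐ[K] K :=
  { Polynomial.eval₂RingHom (y : R →+* K) c with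
    commutes' := fun a => by
      simp [Polynomial.algebraMap_apply] }

@[simp] theorem extPt_C (y : R →ₐ[K] K) (c : K) (a : R) : extPt y c (Polynomial.C a) = y a :=
  Polynomial.eval₂_C _ _

@[simp] theorem extPt_X (y : R →ₐ[K] K) (c : K) : extPt y c Polynomial.X = c :=
  Polynomial.eval₂_X _ _

/-- The point of `R` below a point of `R[X]`. -/
def basePt (z : Polynomial R →ₐ[K] K) : R →ₐ[K] K := z.comp Polynomial.CAlgHom

@[simp] theorem apply_C (z : Polynomial R →ₐ[K] K) (a : R) :
    z (Polynomial.C a) = basePt z a := rfl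

@[simp] theorem basePt_extPt (y : R →ₐ[K] K) (c : K) : basePt (extPt y c) = y := by
  ext a
  exact extPt_C y c a

@[simp] theorem extPt_basePt (z : Polynomial R →ₐ[K] K) : extPt (basePt z) (z Polynomial.X) =
    z := by
  refine Polynomial.algHom_ext' ?_ ?_
  · ext a
    exact extPt_C _ _ a
  · simp

/-- A function on polynomials satisfying the Leibniz rule at a point vanishes if it vanishes on
constants and on the variable. -/
theorem polynomial_leibniz_ext {z : Polynomial R →ₐ[K] K} {d d' : Polynomial R →ₗ[K] K}
    (hd : ∀ a b, d (a * b) = z a * d b + z b * d a)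
    (hd' : ∀ a b, d' (a * b) = z a * d' b + z b * d' a)
    (hC : ∀ a, d (Polynomial.C a) = d' (Polynomial.C a)) (hX : d Polynomial.X = d' Polynomial.X)
    (P : Polynomial R) : d P = d' P := by
  induction P using Polynomial.induction_on with
  | C a => exact hC a
  | add p q hp hq => rw [map_add, map_add, hp, hq]
  | monomial n a h => rw [pow_succ, ← mul_assoc, hd, hd', h, hX]

theorem eq_or_eq_add_one (j b : Fin 2) : j = b ∨ j + 1 = b := by
  revert j b; decide

theorem add_one_ne (j : Fin 2) : j + 1 ≠ j := by
  revert j; decide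

theorem add_one_add_one (j : Fin 2) : j + 1 + 1 = j := by
  revert j; decide

theorem sum_fin_two' {N : Type*} [AddCommMonoid N] (j : Fin 2) (f : Fin 2 → N) :
    ∑ b, f b = f j + f (j + 1) := by
  obtain rfl | rfl := eq_or_eq_add_one 0 j
  · simp
  · rw [Fin.sum_univ_two, add_comm]; rfl

end Polynomial

/-! ### Lines in a distribution -/

namespace Distribution

variable {K : Type u} [Field K] (M : Distribution.{u, max u v} K)

theorem dir_mem (q : M.Points) : M.dir q ∈ M.B q.1 := (q.2.rep : M.B q.1).2

theorem dir_ne_zero (q : M.Points) : M.dir q ≠ 0 := fun h =>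
  q.2.rep_nonzero (Subtype.ext h)

theorem line_eq_span (q : M.Points) : M.line q = Submodule.span K {M.dir q} := by
  rw [line, Projectivization.submodule_eq, Submodule.map_span, Set.image_singleton]
  rfl

variable {M}

theorem exists_dir_eq_smul {x : M.space.carrier} (v : M.B x) (hv : v ≠ 0) :
    ∃ c : K, c ≠ 0 ∧ M.dir ⟨x, Projectivization.mk K v hv⟩ = c • (v : M.space.Functional x) := by
  obtain ⟨a, ha⟩ := Projectivization.exists_smul_eq_mk_rep K v hv
  exact ⟨a, a.ne_zero, by rw [dir, ← ha]; rfl⟩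

theorem mk_eq_of_smul_eq {x : M.space.carrier} (ℓ : ℙ K (M.B x)) (v : M.B x) (hv : v ≠ 0) {c : K}
    (h : M.dir ⟨x, ℓ⟩ = c • (v : M.space.Functional x)) : ℓ = Projectivization.mk K v hv := by
  rw [← ℓ.mk_rep, Projectivization.mk_eq_mk_iff']
  exact ⟨c, Subtype.ext h.symm⟩

theorem points_ext {q r : M.Points} (h : q.1 = r.1) (h' : HEq (M.line q) (M.line r)) : q = r := by
  obtain ⟨x, ℓ⟩ := q
  obtain ⟨x', ℓ'⟩ := r
  obtain rfl : x = x' := h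
  have h'' := eq_of_heq h'
  rw [line, line] at h''
  obtain rfl : ℓ = ℓ' := Projectivization.submodule_injective (Submodule.map_injective_of_injective
    (Submodule.injective_subtype _) h'')
  rfl

theorem dirDeriv_smul {X : FunSpace.{u, v} K} {x : X.carrier} (w : X.Functional x) (c : K)
    (f : X.carrier → K) : dirDeriv (c • w) f = c * dirDeriv w f := by
  unfold dirDeriv
  split_ifs <;> simp

theorem slope_mk {x : M.space.carrier} (v : M.B x) (hv : v ≠ 0) (f g : M.space.carrier → K) :
    M.slope f g ⟨x, Projectivization.mk K v hv⟩ =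
      dirDeriv (v : M.space.Functional x) f / dirDeriv (v : M.space.Functional x) g := by
  obtain ⟨c, hc, h⟩ := exists_dir_eq_smul v hv
  rw [slope, h, dirDeriv_smul, dirDeriv_smul, mul_div_mul_left _ _ hc]

theorem local_comp_fst {D : Set M.space.carrier} {f : M.space.carrier → K} (h : M.space.Local D f) :
    M.proj.Local (Sigma.fst ⁻¹' D) fun q : M.Points => f q.1 :=
  Local.gen (Or.inl ⟨D, f, h, rfl⟩)

theorem local_slope {D E : Set M.space.carrier} {f g : M.space.carrier → K}
    (h : M.space.Local D f) (h' : M.space.Local E g) :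
    M.proj.Local {q : M.Points | q.1 ∈ D ∧ q.1 ∈ E ∧ dirDeriv (M.dir q) g ≠ 0} (M.slope f g) :=
  Local.gen (Or.inr ⟨D, f, E, g, h, h', rfl⟩)

theorem continuous_fst : @Continuous M.proj.carrier M.space.carrier _ _ Sigma.fst := by
  refine ⟨fun U hU => isOpen_iff_mem_nhds.2 fun q hq => ?_⟩
  obtain ⟨D, f, hf, hD, hDU⟩ := exists_local_of_mem_nhds (hU.mem_nhds hq)
  exact Filter.mem_of_superset ((local_comp_fst hf).isOpen.mem_nhds hD) fun r hr => hDU hr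

theorem eventually_dirDeriv_ne_zero (hM : ∀ q, M.B q ≤ M.space.tangent q)
    {q : M.proj.carrier} {f : M.space.carrier → K}
    (hf : f ∈ M.space.regAt (Sigma.fst q)) (h0 : dirDeriv (M.dir q) f ≠ 0) :
    ∀ᶠ r : M.proj.carrier in 𝓝 q, dirDeriv (M.dir r) f ≠ 0 := by
  obtain ⟨D, g, hg, hq, hD⟩ := hf
  have key : ∀ r : M.Points, r.1 ∈ D → dirDeriv (M.dir r) f = dirDeriv (M.dir r) g := fun r hr =>
    dirDeriv_congr (hM _ (M.dir_mem r)) ⟨D, g, hg, hr, hD⟩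
      (Filter.mem_of_superset (hg.isOpen.mem_nhds hr) hD)
  refine Filter.mem_of_superset ((local_slope hg hg).isOpen.mem_nhds ?_) ?_
  · exact ⟨hq, hq, by rwa [← key q hq]⟩
  · rintro r ⟨hr, -, hr'⟩
    rwa [Set.mem_ofPred_eq, key r hr]

theorem slope_mem_regAt (hM : ∀ q, M.B q ≤ M.space.tangent q)
    {q : M.Points} {f g : M.space.carrier → K}
    (hf : f ∈ M.space.regAt q.1) (hg : g ∈ M.space.regAt q.1) (h0 : dirDeriv (M.dir q) g ≠ 0) :
    M.slope f g ∈ M.proj.regAt q := by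
  obtain ⟨D, f', hf', hq, hD⟩ := hf
  obtain ⟨E, g', hg', hq', hE⟩ := hg
  have key : ∀ r : M.Points, r.1 ∈ D → dirDeriv (M.dir r) f = dirDeriv (M.dir r) f' := fun r hr =>
    dirDeriv_congr (hM _ (M.dir_mem r)) ⟨D, f', hf', hr, hD⟩
      (Filter.mem_of_superset (hf'.isOpen.mem_nhds hr) hD)
  have key' : ∀ r : M.Points, r.1 ∈ E → dirDeriv (M.dir r) g = dirDeriv (M.dir r) g' := fun r hr =>
    dirDeriv_congr (hM _ (M.dir_mem r)) ⟨E, g', hg', hr, hE⟩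
      (Filter.mem_of_superset (hg'.isOpen.mem_nhds hr) hE)
  refine ⟨_, _, local_slope hf' hg', ⟨hq, hq', by rwa [← key' q hq']⟩, ?_⟩
  rintro r ⟨hr, hr', -⟩
  change _ / _ = _ / _
  rw [key r hr, key' r hr']

theorem dproj_mem_tangent {q : M.Points} {w : M.proj.Functional q} (hw : w ∈ M.proj.tangent q) :
    M.dproj q w ∈ M.space.tangent q.1 := fun f g =>
  hw ⟨_, M.comp_fst_mem_regAt q f⟩ ⟨_, M.comp_fst_mem_regAt q g⟩

theorem mem_next_B {q : M.Points} {w : M.proj.Functional q} (hw : w ∈ M.proj.tangent q) :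
    w ∈ M.next.B q ↔ M.dproj q w ∈ M.line q := by
  change w ∈ M.proj.tangent q ⊓ (M.line q).comap (M.dproj q) ↔ _
  simp [hw]

end Distribution

open FunSpace Monster.Distribution AffineChart

namespace Chart

variable {K : Type u} [Field K] [IsAlgClosed K] [CharZero K] {M : Distribution.{u, max u v} K}
  (Φ : Chart.{u, v} M) (j : Fin 2)

/-- The coordinates of the chart of the projectivization. -/
def nextX (b : Fin 2) : Polynomial Φ.R :=
  if b = j then Polynomial.C (Φ.X j) else Polynomial.X

/-- The frame of the focal bundle in a chart of the projectivization. -/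
def nextδ (b : Fin 2) : Derivation K (Polynomial Φ.R) (Polynomial Φ.R) :=
  if b = j then coeffDer (Φ.δ j) + (Polynomial.X : Polynomial Φ.R) • coeffDer (Φ.δ (j + 1))
  else varDer

@[simp] theorem nextX_self : Φ.nextX j j = Polynomial.C (Φ.X j) := by simp [nextX]

@[simp] theorem nextX_add_one : Φ.nextX j (j + 1) = Polynomial.X := by simp [nextX]

theorem nextδ_self_C (a : Φ.R) : Φ.nextδ j j (Polynomial.C a) =
    Polynomial.C (Φ.δ j a) + Polynomial.X * Polynomial.C (Φ.δ (j + 1) a) := by simp [nextδ]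

@[simp] theorem nextδ_self_X : Φ.nextδ j j Polynomial.X = 0 := by simp [nextδ]

@[simp] theorem nextδ_add_one_C (a : Φ.R) : Φ.nextδ j (j + 1) (Polynomial.C a) = 0 := by
  simp [nextδ]

@[simp] theorem nextδ_add_one_X : Φ.nextδ j (j + 1) Polynomial.X = 1 := by
  simp [nextδ]

theorem nextδ_nextX (j a b : Fin 2) : Φ.nextδ j a (Φ.nextX j b) = if a = b then 1 else 0 := by
  obtain rfl | rfl := eq_or_eq_add_one j a <;> obtain rfl | rfl := eq_or_eq_add_one j b <;>
    simp [nextδ_self_C, Φ.δ_X, (add_one_ne _).symm]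

variable {j}

theorem exists_frame (y : Φ.R →ₐ[K] K) (j : Fin 2) (c : K) :
    ∃ w : M.B (Φ.Θ y), ∀ a, w.1 (Φ.reg y a) = y (Φ.δ j a) + c * y (Φ.δ (j + 1) a) := by
  obtain ⟨w, hw, h⟩ := Φ.exists_mem_B y fun b => if b = j then 1 else c
  refine ⟨⟨w, hw⟩, fun a => ?_⟩
  rw [h, sum_fin_two' j]
  simp

/-- The vector of the distribution with `j`th coordinate `1` and other coordinate `c`. -/
def frame (y : Φ.R →ₐ[K] K) (j : Fin 2) (c : K) : M.B (Φ.Θ y) := (Φ.exists_frame y j c).choose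

theorem frame_apply (y : Φ.R →ₐ[K] K) (j : Fin 2) (c : K) (a : Φ.R) :
    (Φ.frame y j c).1 (Φ.reg y a) = y (Φ.δ j a) + c * y (Φ.δ (j + 1) a) :=
  (Φ.exists_frame y j c).choose_spec a

theorem frame_apply_X (y : Φ.R →ₐ[K] K) (j : Fin 2) (c : K) :
    (Φ.frame y j c).1 (Φ.reg y (Φ.X j)) = 1 := by
  rw [frame_apply, Φ.δ_X, Φ.δ_X]
  simp

theorem frame_apply_X_add_one (y : Φ.R →ₐ[K] K) (j : Fin 2) (c : K) :
    (Φ.frame y j c).1 (Φ.reg y (Φ.X (j + 1))) = c := by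
  rw [frame_apply, Φ.δ_X, Φ.δ_X]
  simp [(add_one_ne _).symm]

theorem frame_ne_zero (y : Φ.R →ₐ[K] K) (j : Fin 2) (c : K) : Φ.frame y j c ≠ 0 := by
  intro h
  have := Φ.frame_apply_X y j c
  rw [h] at this
  exact one_ne_zero this.symm

theorem frame_mem_tangent (y : Φ.R →ₐ[K] K) (j : Fin 2) (c : K) :
    (Φ.frame y j c).1 ∈ M.space.tangent (Φ.Θ y) := Φ.B_le _ (Φ.frame y j c).2

theorem eq_smul_frame {y : Φ.R →ₐ[K] K} {w : M.space.Functional (Φ.Θ y)} (hw : w ∈ M.B (Φ.Θ y))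
    {j : Fin 2} {c : K}
    (h : w (Φ.reg y (Φ.X (j + 1))) = w (Φ.reg y (Φ.X j)) * c) :
    w = w (Φ.reg y (Φ.X j)) • (Φ.frame y j c).1 := by
  refine B_ext hw (Submodule.smul_mem _ _ (Φ.frame y j c).2) fun b => ?_
  obtain rfl | rfl := eq_or_eq_add_one j b
  · simp [frame_apply_X]
  · simp [frame_apply_X_add_one, h]

/-- The parametrization of a chart of the projectivization. -/
abbrev nextΘ (j : Fin 2) (z : Polynomial Φ.R →ₐ[K] K) : M.proj.carrier :=
  (⟨Φ.Θ (basePt z), Projectivization.mk K (Φ.frame (basePt z) j (z Polynomial.X))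
    (Φ.frame_ne_zero _ _ _)⟩ : M.Points)

theorem nextΘ_extPt (y : Φ.R →ₐ[K] K) (c : K) : Φ.nextΘ j (extPt y c) =
    (⟨Φ.Θ y, Projectivization.mk K (Φ.frame y j c) (Φ.frame_ne_zero _ _ _)⟩ : M.Points) := by
  have key : ∀ (y' : Φ.R →ₐ[K] K) (c' : K), y' = y → c' = c →
      (⟨Φ.Θ y', Projectivization.mk K (Φ.frame y' j c') (Φ.frame_ne_zero _ _ _)⟩ : M.Points) =
        ⟨Φ.Θ y, Projectivization.mk K (Φ.frame y j c) (Φ.frame_ne_zero _ _ _)⟩ := by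
    rintro _ _ rfl rfl
    rfl
  exact key _ _ (basePt_extPt y c) (extPt_X y c)

theorem exists_dir_nextΘ (j : Fin 2) (z : Polynomial Φ.R →ₐ[K] K) : ∃ c : K, c ≠ 0 ∧
    (M.dir (Φ.nextΘ j z) : M.space.Functional (Φ.Θ (basePt z))) =
      c • (Φ.frame (basePt z) j (z Polynomial.X)).1 :=
  exists_dir_eq_smul _ _

theorem line_nextΘ (z : Polynomial Φ.R →ₐ[K] K) :
    M.line (Φ.nextΘ j z) = Submodule.span K {(Φ.frame (basePt z) j (z Polynomial.X)).1} := by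
  obtain ⟨c, hc, h⟩ := Φ.exists_dir_nextΘ j z
  rw [line_eq_span, h]
  exact Submodule.span_singleton_smul_eq (IsUnit.mk0 c hc) _

/-- A point over a chart with nonvanishing `j`th coordinate of its line is in the next chart. -/
theorem eq_nextΘ {y : Φ.R →ₐ[K] K} {ℓ : ℙ K (M.B (Φ.Θ y))}
    (h : M.dir ⟨Φ.Θ y, ℓ⟩ (Φ.reg y (Φ.X j)) ≠ 0) :
    (⟨Φ.Θ y, ℓ⟩ : M.Points) = Φ.nextΘ j (extPt y (M.dir ⟨Φ.Θ y, ℓ⟩ (Φ.reg y (Φ.X (j + 1))) /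
      M.dir ⟨Φ.Θ y, ℓ⟩ (Φ.reg y (Φ.X j)))) := by
  have h1 := Φ.eq_smul_frame (M.dir_mem ⟨Φ.Θ y, ℓ⟩) (j := j) (mul_div_cancel₀ _ h).symm
  have h2 := mk_eq_of_smul_eq ℓ _ (Φ.frame_ne_zero y j _) h1
  rw [nextΘ_extPt, ← h2]

theorem mem_range_nextΘ {q : M.proj.carrier} : q ∈ Set.range (Φ.nextΘ j) ↔
    Sigma.fst q ∈ Set.range Φ.Θ ∧ dirDeriv (M.dir q) (Φ.ext (Φ.X j)) ≠ 0 := by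
  constructor
  · rintro ⟨z, rfl⟩
    refine ⟨⟨_, rfl⟩, ?_⟩
    obtain ⟨c, hc, h⟩ := Φ.exists_dir_nextΘ j z
    rw [h, dirDeriv_smul, dirDeriv_eq _ (Φ.ext_mem_regAt _ _)]
    refine mul_ne_zero hc ?_
    change (Φ.frame (basePt z) j (z Polynomial.X)).1 (Φ.reg _ (Φ.X j)) ≠ 0
    rw [frame_apply_X]
    exact one_ne_zero
  · obtain ⟨x, ℓ⟩ := q
    rintro ⟨⟨y, hy⟩, h⟩
    change Φ.Θ y = x at hy
    subst hy
    rw [dirDeriv_eq _ (Φ.ext_mem_regAt _ _)] at h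
    exact ⟨_, (Φ.eq_nextΘ h).symm⟩

theorem slope_nextΘ (z : Polynomial Φ.R →ₐ[K] K) :
    M.slope (Φ.ext (Φ.X (j + 1))) (Φ.ext (Φ.X j)) (Φ.nextΘ j z) = z Polynomial.X := by
  refine (slope_mk _ _ _ _).trans ?_
  rw [dirDeriv_eq _ (Φ.ext_mem_regAt _ _), dirDeriv_eq _ (Φ.ext_mem_regAt _ _)]
  refine (congrArg₂ _ (Φ.frame_apply_X_add_one _ _ _) (Φ.frame_apply_X _ _ _)).trans ?_
  simp

theorem nextΘ_injective : Function.Injective (Φ.nextΘ j) := by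
  intro z z' h
  have h1 : basePt z = basePt z' := Φ.injective (congrArg (fun q : M.Points => q.1) h)
  have h2 : z Polynomial.X = z' Polynomial.X := by rw [← Φ.slope_nextΘ, h, Φ.slope_nextΘ]
  rw [← extPt_basePt z, h1, h2, extPt_basePt]

theorem isOpen_range_nextΘ : IsOpen (Set.range (Φ.nextΘ j)) := by
  rw [isOpen_iff_mem_nhds]
  intro q hq
  have hq' := Φ.mem_range_nextΘ.1 hq
  obtain ⟨z, rfl⟩ := hq
  filter_upwards [continuous_fst.continuousAt.preimage_mem_nhds
      (Φ.isOpen_range.mem_nhds hq'.1),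
    eventually_dirDeriv_ne_zero Φ.B_le (Φ.ext_mem_regAt (Φ.X j) (basePt z)) hq'.2] with r h1 h2
  exact Φ.mem_range_nextΘ.2 ⟨h1, h2⟩

theorem nextΘ_ext_mem (P : Polynomial Φ.R) (z : Polynomial Φ.R →ₐ[K] K) :
    Function.extend (Φ.nextΘ j) (fun z => z P) 0 ∈ M.proj.regAt (Φ.nextΘ j z) := by
  have hev : ∀ᶠ q in 𝓝 (Φ.nextΘ j z), q ∈ Set.range (Φ.nextΘ j) :=
    Φ.isOpen_range_nextΘ.mem_nhds ⟨z, rfl⟩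
  have happ : ∀ P z, Function.extend (Φ.nextΘ j) (fun z => z P) 0 (Φ.nextΘ j z) = z P :=
    fun P z => Φ.nextΘ_injective.extend_apply _ _ _
  induction P using Polynomial.induction_on with
  | C a =>
    refine regAt_congr (M.comp_fst_mem_regAt (Φ.nextΘ j z) (Φ.reg (basePt z) a)) ?_
    filter_upwards [hev]
    rintro _ ⟨z', rfl⟩
    rw [happ]
    exact Φ.ext_apply a (basePt z')
  | add p q hp hq =>
    refine regAt_congr (add_mem hp hq) ?_
    filter_upwards [hev]
    rintro _ ⟨z', rfl⟩
    rw [Pi.add_apply, happ, happ, happ, map_add]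
  | monomial n a h =>
    have hX : M.slope (Φ.ext (Φ.X (j + 1))) (Φ.ext (Φ.X j)) ∈ M.proj.regAt (Φ.nextΘ j z) :=
      slope_mem_regAt Φ.B_le (Φ.ext_mem_regAt _ (basePt z)) (Φ.ext_mem_regAt _ (basePt z))
        (Φ.mem_range_nextΘ.1 ⟨z, rfl⟩).2
    refine regAt_congr (mul_mem h hX) ?_
    filter_upwards [hev]
    rintro _ ⟨z', rfl⟩
    refine (congrArg₂ (· * ·) (happ _ z') (Φ.slope_nextΘ z')).trans ?_
    rw [happ, pow_succ, ← mul_assoc, map_mul _ _ Polynomial.X]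

theorem nextΘ_exists_fraction {D : Set M.proj.carrier} {f : M.proj.carrier → K}
    (h : M.proj.Local D f) (z : Polynomial Φ.R →ₐ[K] K) (hz : Φ.nextΘ j z ∈ D) :
    ∃ a b : Polynomial Φ.R, z b ≠ 0 ∧
      ∀ z', z' b ≠ 0 → Φ.nextΘ j z' ∈ D ∧ f (Φ.nextΘ j z') = z' a / z' b := by
  refine (h.exists_fraction (Φ.nextΘ j) Set.univ ?_ z (Set.mem_univ z) hz).imp
    fun a ⟨b, hb, H⟩ => ⟨b, hb, fun z' hz' => H z' (Set.mem_univ _) hz'⟩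
  clear hz h z f D
  rintro D f (⟨D, f, hf, h⟩ | ⟨D, f, E, g, hf, hg, h⟩) z - hz
  · obtain ⟨rfl, rfl⟩ := Prod.mk.inj h
    obtain ⟨a, b, hb, H⟩ := Φ.exists_fraction hf (basePt z) hz
    exact ⟨Polynomial.C a, Polynomial.C b, hb, fun z' _ hz' => H (basePt z') hz'⟩
  · obtain ⟨rfl, rfl⟩ := Prod.mk.inj h
    obtain ⟨hz1, hz2, hz3⟩ := hz
    obtain ⟨a, b, hb, H⟩ := Φ.exists_fraction hf (basePt z) hz1
    obtain ⟨a', b', hb', H'⟩ := Φ.exists_fraction hg (basePt z) hz2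
    let N : Φ.R → Φ.R → Polynomial Φ.R := fun a b =>
      Polynomial.C b * Φ.nextδ j j (Polynomial.C a) - Polynomial.C a * Φ.nextδ j j (Polynomial.C b)
    have key : ∀ {D f a b}, M.space.Local D f →
        (∀ z, z b ≠ 0 → Φ.Θ z ∈ D ∧ f (Φ.Θ z) = z a / z b) →
        ∀ z : Polynomial Φ.R →ₐ[K] K, basePt z b ≠ 0 →
        dirDeriv (Φ.frame (basePt z) j (z Polynomial.X)).1 f = z (N a b) / (basePt z b) ^ 2 := by
      intro D f a b hf H z hz
      rw [dirDeriv_eq _ (hf.mem_regAt (H _ hz).1),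
        Φ.apply_of_fraction (Φ.frame_mem_tangent _ _ _) _ hz fun z' hz' => (H z' hz').2]
      simp only [frame_apply, N, nextδ_self_C, map_sub, map_mul, map_add, apply_C]
    refine ⟨N a b * Polynomial.C (b' ^ 3), Polynomial.C (b ^ 2) * N a' b' * Polynomial.C b', ?_,
      fun z' _ hz' => ?_⟩
    · obtain ⟨c, hc, h⟩ := Φ.exists_dir_nextΘ j z
      rw [h, dirDeriv_smul, key hg H' z hb'] at hz3
      simp only [map_mul, map_pow, apply_C]
      simp_all
    · simp only [map_mul, map_pow, apply_C, ne_eq, mul_eq_zero, not_or] at hz'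
      have h1 : basePt z' b ≠ 0 := fun h => hz'.1.1 (by simp [h])
      have h2 := hz'.1.2
      have h3 := hz'.2
      refine ⟨⟨(H _ h1).1, (H' _ h3).1, ?_⟩, ?_⟩
      · obtain ⟨c, hc, h⟩ := Φ.exists_dir_nextΘ j z'
        rw [h, dirDeriv_smul, key hg H' z' h3]
        simp [hc, h2, h3]
      · refine (slope_mk _ _ _ _).trans ?_
        rw [key hf H z' h1, key hg H' z' h3]
        simp only [map_mul, map_pow, apply_C]
        field_simp

variable (j)

/-- The chart of the space of a projectivization on which the `j`th coordinate is retained. -/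
abbrev nextAffine : AffineChart.{u, v} M.next.space where
  R := Polynomial Φ.R
  Θ := Φ.nextΘ j
  injective := Φ.nextΘ_injective
  isOpen_range := Φ.isOpen_range_nextΘ
  ext_mem := Φ.nextΘ_ext_mem
  exists_fraction := Φ.nextΘ_exists_fraction

theorem nextAffine_reg_C (z : Polynomial Φ.R →ₐ[K] K)
    {w : M.proj.Functional (Φ.nextΘ j z)} (hw : w ∈ M.proj.tangent (Φ.nextΘ j z)) (a : Φ.R) :
    w ((Φ.nextAffine j).reg z (Polynomial.C a)) =
      M.dproj (Φ.nextΘ j z) w (Φ.reg (basePt z) a) := by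
  refine tangent_congr hw ?_
  filter_upwards [(Φ.nextAffine j).isOpen_range.mem_nhds ⟨z, rfl⟩]
  rintro _ ⟨z', rfl⟩
  exact ((Φ.nextAffine j).ext_apply (Polynomial.C a) z').trans (Φ.ext_apply a (basePt z')).symm

theorem eq_sum_iff {z : Polynomial Φ.R →ₐ[K] K} {d : Polynomial Φ.R →ₗ[K] K}
    (hd : ∀ a b, d (a * b) = z a * d b + z b * d a) :
    (∀ P, d P = ∑ b, d (Φ.nextX j b) * z (Φ.nextδ j b P)) ↔
      ∀ a, d (Polynomial.C a) = d (Polynomial.C (Φ.X j)) *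
        (basePt z (Φ.δ j a) + z Polynomial.X * basePt z (Φ.δ (j + 1) a)) := by
  constructor
  · intro h a
    rw [h, sum_fin_two' j]
    simp [nextδ_self_C]
    exact Or.inl (mul_comm _ _)
  · intro h P
    refine (polynomial_leibniz_ext (d' := ∑ b, d (Φ.nextX j b) •
      (z.toLinearMap.comp (Φ.nextδ j b).toLinearMap)) hd ?_ ?_ ?_ P).trans (by simp)
    · intro a b
      simp [sum_fin_two' j]
      ring
    · intro a
      rw [h]
      simp [sum_fin_two' j, nextδ_self_C]
      exact Or.inl (mul_comm _ _)
    · simp [sum_fin_two' j]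

/-- The chart of the projectivization with its focal bundle on which the `j`th coordinate is
retained. -/
abbrev next : Chart.{u, v} M.next where
  toAffineChart := Φ.nextAffine j
  X := Φ.nextX j
  δ := Φ.nextδ j
  δ_X := Φ.nextδ_nextX j
  B_le _ := inf_le_left
  mem_B_iff' z w hw := by
    refine (mem_next_B hw).trans ?_
    refine Iff.trans ?_ (Φ.eq_sum_iff j (d := w.comp ((Φ.nextAffine j).reg z))
      fun a b => pull_mul hw a b).symm
    refine (iff_of_eq (congrArg (M.dproj (Φ.nextΘ j z) w ∈ ·) (Φ.line_nextΘ z))).trans ?_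
    have hC := Φ.nextAffine_reg_C j z hw
    refine Submodule.mem_span_singleton.trans ⟨?_, fun h => ?_⟩
    · rintro ⟨c, hc⟩
      have h1 : ∀ a, w ((Φ.nextAffine j).reg z (Polynomial.C a)) =
          c * (basePt z (Φ.δ j a) + z Polynomial.X * basePt z (Φ.δ (j + 1) a)) := by
        intro a
        refine (hC a).trans ((LinearMap.congr_fun hc _).symm.trans ?_)
        exact congrArg (c * ·) (Φ.frame_apply _ _ _ _)
      intro a
      refine (h1 a).trans (congrArg (· * _) ?_)
      refine Eq.trans ?_ (h1 _).symm
      simp [Φ.δ_X]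
    · refine ⟨w ((Φ.nextAffine j).reg z (Polynomial.C (Φ.X j))), ?_⟩
      refine tangent_ext (Φ := Φ.toAffineChart) (Submodule.smul_mem _ _ (Φ.frame_mem_tangent _ _ _))
        (dproj_mem_tangent hw) fun a => ?_
      refine Eq.trans ?_ ((h a).symm.trans (hC a))
      exact congrArg (_ * ·) (Φ.frame_apply _ _ _ _)

end Chart

theorem derivation_mem_sup_span {K : Type u} [Field K] {R : Type v} [CommRing R] [Algebra K R]
    (θ : Derivation K R R) {I J : Ideal R} (hJ : ∀ a ∈ J, θ a ∈ I) {g : R}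
    (hgI : g ∈ I) (hg : θ g ∈ I) : ∀ a ∈ J ⊔ Ideal.span {g}, θ a ∈ I := by
  intro a ha
  obtain ⟨b, hb, c, hc, rfl⟩ := Submodule.mem_sup.1 ha
  obtain ⟨r, rfl⟩ := Ideal.mem_span_singleton'.1 hc
  rw [map_add, Derivation.leibniz, smul_eq_mul, smul_eq_mul]
  exact I.add_mem (hJ b hb) (I.add_mem (I.mul_mem_left _ hg) (I.mul_mem_right _ hgI))

theorem derivation_mem_of_map {K : Type u} [Field K] {R R' : Type v} [CommRing R] [Algebra K R]
    [CommRing R'] [Algebra K R'] (f : R →+* R')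
    (θ : Derivation K R' R') {I : Ideal R'} {J : Ideal R} (hJI : J.map f ≤ I)
    (hJ : ∀ a ∈ J, θ (f a) ∈ I) : ∀ a ∈ J.map f, θ a ∈ I := by
  intro a ha
  induction ha using Submodule.span_induction with
  | mem a h =>
    obtain ⟨b, hb, rfl⟩ := h
    exact hJ b hb
  | zero => simp
  | add a b _ _ ha hb => rw [map_add]; exact I.add_mem ha hb
  | smul r a h ha =>
    rw [smul_eq_mul, Derivation.leibniz, smul_eq_mul, smul_eq_mul]
    exact I.add_mem (I.mul_mem_left _ ha) (I.mul_mem_right _ (hJI h))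

theorem vanish_sup_iff {K : Type u} [Field K] {R : Type v} [CommRing R] [Algebra K R]
    {I : Ideal R} {g : R} {y : R →ₐ[K] K} :
    (∀ a ∈ I ⊔ Ideal.span {g}, y a = 0) ↔ (∀ a ∈ I, y a = 0) ∧ y g = 0 := by
  change (I ⊔ Ideal.span {g} ≤ RingHom.ker y) ↔ (I ≤ RingHom.ker y) ∧ _
  rw [sup_le_iff, Ideal.span_singleton_le_iff_mem, RingHom.mem_ker]

theorem vanish_map_C_iff {K : Type u} [Field K] {R : Type v} [CommRing R] [Algebra K R]
    {I : Ideal R} {z : Polynomial R →ₐ[K] K} :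
    (∀ a ∈ I.map Polynomial.C, z a = 0) ↔ ∀ a ∈ I, basePt z a = 0 := by
  change (I.map Polynomial.C ≤ RingHom.ker z) ↔ _
  rw [Ideal.map_le_iff_le_comap]
  rfl

namespace AffineChart

variable {K : Type u} [Field K] {S : FunSpace.{u, max u v} K} {Φ : AffineChart.{u, v} S}
  {y : Φ.R →ₐ[K] K}

theorem mem_tangentTo_iff {C : Set S.carrier} (hy : Φ.Θ y ∈ C) {w : S.Functional (Φ.Θ y)}
    (hw : w ∈ S.tangent (Φ.Θ y)) : w ∈ S.tangentTo C (Φ.Θ y) ↔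
      ∀ a b, y b ≠ 0 → (∀ z, Φ.Θ z ∈ C → z b ≠ 0 → z a = 0) → w (Φ.reg y a) = 0 := by
  constructor
  · intro h a b hb H
    refine h.2 _ (eventually_nhdsWithin_iff.2 (eventually_of_forall hb fun z hz hzC => ?_))
    simpa using H z hzC hz
  · refine fun h => ⟨hw, fun f hf => ?_⟩
    obtain ⟨b', hb', H'⟩ := exists_of_eventually (eventually_nhdsWithin_iff.1 hf)
    obtain ⟨a, b, hb, H⟩ := exists_fraction_of_mem_regAt f.2
    have key : ∀ z, Φ.Θ z ∈ C → z (b * b') ≠ 0 → z a = 0 := by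
      intro z hz hzb
      rw [map_mul, mul_ne_zero_iff] at hzb
      have := H' z hzb.2 hz
      rw [H z hzb.1, div_eq_zero_iff] at this
      exact this.resolve_right hzb.1
    have hbb : y (b * b') ≠ 0 := by simp [hb, hb']
    rw [apply_of_fraction hw f hb H, h a _ hbb key, key y hy hbb]
    simp

theorem exists_of_mem_closure {C : Set S.carrier} {y : Φ.R →ₐ[K] K} (hC : Φ.Θ y ∈ closure C)
    {b : Φ.R} (hb : y b ≠ 0) : ∃ z, Φ.Θ z ∈ C ∧ z b ≠ 0 := by
  rw [mem_closure_iff_nhds] at hC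
  obtain ⟨q, ⟨z, rfl, hz⟩, hq⟩ := hC _ (eventually_of_forall
    (p := fun q => ∃ z, Φ.Θ z = q ∧ z b ≠ 0)
    hb fun z hz => ⟨z, rfl, hz⟩)
  exact ⟨z, hq, hz⟩

end AffineChart

/-- The derivation of a chart which multiplies the coordinates with given weights. -/
def Chart.euler {K : Type u} [Field K] {M : Distribution.{u, max u v} K} (Φ : Chart.{u, v} M)
    (m : Fin 2 → ℤ) : Derivation K Φ.R Φ.R := ∑ b, ((m b : Φ.R) * Φ.X b) • Φ.δ b

theorem Chart.euler_apply {K : Type u} [Field K] {M : Distribution.{u, max u v} K}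
    (Φ : Chart.{u, v} M) (m : Fin 2 → ℤ) (j : Fin 2) (a : Φ.R) :
    Φ.euler m a = m j * Φ.X j * Φ.δ j a + m (j + 1) * Φ.X (j + 1) * Φ.δ (j + 1) a := by
  simp [Chart.euler, sum_fin_two' j]

theorem Chart.euler_X {K : Type u} [Field K] {M : Distribution.{u, max u v} K}
    (Φ : Chart.{u, v} M) (m : Fin 2 → ℤ) (b : Fin 2) :
    Φ.euler m (Φ.X b) = m b * Φ.X b := by
  simp [Φ.euler_apply m b, Φ.δ_X]

/-- A chart in which the total space of a family of curves `C t` for `t ≠ 0` has a simple form: it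
is the zero locus of an ideal `J`, with coordinates `X 0`, `X 1`, such that the parameter
`tt` vanishes when one of the coordinates does, and the curves are tangent to a diagonal vector
field. -/
structure FamChart {K : Type u} [Field K] (M : Distribution.{u, max u v} K)
    (C : K → Set M.space.carrier) extends Chart.{u, v} M where
  wt : Fin 2 → ℤ
  wt_pos : 0 < wt 0
  wt_neg : wt 1 < 0
  J : Ideal R
  tt : R
  η : Fin 2 → Derivation K R R
  η_X : ∀ a b, η a (X b) = if a = b then 1 else 0
  η_J : ∀ b, ∀ a ∈ J, η b a ∈ J
  euler_J : ∀ a ∈ J, toChart.euler wt a ∈ J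
  euler_tt : toChart.euler wt tt ∈ J
  unram : ∀ y : R →ₐ[K] K, (∀ a ∈ J, y a = 0) → y tt ≠ 0 → ∀ d : R →ₗ[K] K,
    (∀ a b, d (a * b) = y a * d b + y b * d a) → (∀ a ∈ J, d a = 0) → d tt = 0 →
      ∃ c, ∀ a, d a = c * y (toChart.euler wt a)
  tt_eq_zero : ∀ y : R →ₐ[K] K, (∀ a ∈ J, y a = 0) → (y tt = 0 ↔ ∃ b, y (X b) = 0)
  mem_curve : ∀ t ≠ 0, ∀ y : R →ₐ[K] K, Θ y ∈ C t ↔ (∀ a ∈ J, y a = 0) ∧ y tt = t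

namespace FamChart

variable {K : Type u} [Field K] {M : Distribution.{u, max u v} K}
  {C : K → Set M.space.carrier} (Φ : FamChart.{u, v} M C)

theorem wt_ne_zero (b : Fin 2) : Φ.wt b ≠ 0 := by
  fin_cases b
  exacts [Φ.wt_pos.ne', Φ.wt_neg.ne]

variable [IsAlgClosed K] [CharZero K]

theorem wt_cast_ne_zero (b : Fin 2) : (Φ.wt b : K) ≠ 0 := Int.cast_ne_zero.2 (Φ.wt_ne_zero b)

theorem exists_tangentTo_eq_span {t : K} (ht : t ≠ 0) {y : Φ.R →ₐ[K] K} (hy : Φ.Θ y ∈ C t) :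
    ∃ e ∈ M.B (Φ.Θ y), (∀ a, e (Φ.reg y a) = y (Φ.euler Φ.wt a)) ∧
      M.space.tangentTo (C t) (Φ.Θ y) = Submodule.span K {e} := by
  obtain ⟨e, he, hee⟩ := Φ.exists_tangent y (Φ.euler Φ.wt)
  obtain ⟨hyJ, hyt⟩ := (Φ.mem_curve t ht y).1 hy
  refine ⟨e, (Chart.mem_B_iff he).2 fun a => ?_, hee, le_antisymm (fun w hw => ?_) ?_⟩
  · simp only [hee, Chart.euler_X]
    rw [Φ.euler_apply Φ.wt 0, Fin.sum_univ_two]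
    simp
  · have h := (mem_tangentTo_iff hy hw.1).1 hw
    have h1 : ∀ a, (∀ z, Φ.Θ z ∈ C t → z a = 0) → w (Φ.reg y a) = 0 := fun a ha =>
      h a 1 (by simp) fun z hz _ => ha z hz
    have hd := fun a b => pull_mul hw.1 a b
    have hd1 : w (Φ.reg y 1) = 0 := by simpa using hd 1 1
    obtain ⟨c, hc⟩ := Φ.unram y hyJ (by rwa [hyt]) (w.comp (Φ.reg y)) hd
      (fun a ha => h1 a fun z hz => ((Φ.mem_curve t ht z).1 hz).1 a ha) (by
        have := h1 (Φ.tt - t • 1) fun z hz => by simp [((Φ.mem_curve t ht z).1 hz).2]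
        simpa [hd1] using this)
    refine Submodule.mem_span_singleton.2 ⟨c, tangent_ext (Submodule.smul_mem _ _ he) hw.1 ?_⟩
    intro a
    rw [LinearMap.smul_apply, hee, smul_eq_mul, ← hc]
    rfl
  · rw [Submodule.span_singleton_le_iff_mem, mem_tangentTo_iff hy he]
    intro a b hb h
    rw [hee]
    have hle : Φ.J ≤ Φ.J ⊔ Ideal.span {Φ.tt - algebraMap K Φ.R t} := le_sup_left
    refine derivation_apply_eq_zero _ (I := Φ.J ⊔ Ideal.span {Φ.tt - algebraMap K Φ.R t})
      (derivation_mem_sup_span _ (fun a ha => hle (Φ.euler_J a ha))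
        (Ideal.mem_sup_right (Ideal.mem_span_singleton_self _)) ?_) ?_ hb fun z hz hzb => ?_
    · rw [map_sub, Derivation.map_algebraMap, sub_zero]
      exact hle Φ.euler_tt
    · rw [vanish_sup_iff]
      exact ⟨hyJ, by simp [hyt]⟩
    · rw [vanish_sup_iff] at hz
      exact h z ((Φ.mem_curve t ht z).2 ⟨hz.1, by simpa [sub_eq_zero] using hz.2⟩) hzb

variable (j : Fin 2)

/-- The weights of the coordinates on the next level. -/
def nextWt (b : Fin 2) : ℤ := if b = j then Φ.wt j else Φ.wt (j + 1) - Φ.wt j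

/-- The relation between the coordinates of two subsequent levels along the family. -/
def rel : Polynomial Φ.R :=
  Polynomial.C (Φ.wt j * Φ.X j) * Polynomial.X - Polynomial.C (Φ.wt (j + 1) * Φ.X (j + 1))

/-- The ideal of the family on the next level. -/
def nextJ : Ideal (Polynomial Φ.R) := Φ.J.map Polynomial.C ⊔ Ideal.span {Φ.rel j}

/-- The ratio of the weights. -/
def ratio : Polynomial Φ.R := algebraMap K _ ((Φ.wt j : K) / Φ.wt (j + 1))

theorem ratio_mul : Φ.ratio j * (Φ.wt (j + 1) : Polynomial Φ.R) = (Φ.wt j : Polynomial Φ.R) := by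
  have := Φ.wt_cast_ne_zero (j + 1)
  rw [ratio, ← map_intCast (algebraMap K (Polynomial Φ.R)), ← map_mul, div_mul_cancel₀ _ this,
    map_intCast]

/-- The coordinate vector fields on the total space of the family on the next level. -/
def nextη (b : Fin 2) : Derivation K (Polynomial Φ.R) (Polynomial Φ.R) :=
  if b = j then coeffDer (Φ.η j) + (Φ.ratio j * Polynomial.X) • coeffDer (Φ.η (j + 1))
  else (Φ.ratio j * Polynomial.C (Φ.X j)) • coeffDer (Φ.η (j + 1)) + varDer

variable {j}

@[simp] theorem nextWt_self : Φ.nextWt j j = Φ.wt j := by simp [nextWt]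

@[simp] theorem nextWt_add_one : Φ.nextWt j (j + 1) = Φ.wt (j + 1) - Φ.wt j := by simp [nextWt]

theorem mem_nextJ_iff {z : Polynomial Φ.R →ₐ[K] K} : (∀ a ∈ Φ.nextJ j, z a = 0) ↔
    (∀ a ∈ Φ.J, basePt z a = 0) ∧
      Φ.wt j * basePt z (Φ.X j) * z Polynomial.X = Φ.wt (j + 1) * basePt z (Φ.X (j + 1)) := by
  rw [nextJ, vanish_sup_iff, vanish_map_C_iff]
  simp [rel, sub_eq_zero]

theorem rel_mem_nextJ : Φ.rel j ∈ Φ.nextJ j :=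
  Ideal.mem_sup_right (Ideal.mem_span_singleton_self _)

theorem C_mem_nextJ {a : Φ.R} (ha : a ∈ Φ.J) : Polynomial.C a ∈ Φ.nextJ j :=
  Ideal.mem_sup_left (Ideal.mem_map_of_mem _ ha)

theorem nextη_self (P : Polynomial Φ.R) : Φ.nextη j j P =
    coeffDer (Φ.η j) P + Φ.ratio j * Polynomial.X * coeffDer (Φ.η (j + 1)) P := by
  simp [nextη]

theorem nextη_add_one (P : Polynomial Φ.R) : Φ.nextη j (j + 1) P =
    Φ.ratio j * Polynomial.C (Φ.X j) * coeffDer (Φ.η (j + 1)) P + varDer (K := K) P := by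
  simp [nextη]

theorem nextη_nextX (j a b : Fin 2) :
    Φ.nextη j a (Φ.nextX j b) = if a = b then 1 else 0 := by
  obtain rfl | rfl := eq_or_eq_add_one j a <;> obtain rfl | rfl := eq_or_eq_add_one j b <;>
    simp [nextη_self, nextη_add_one, Φ.η_X]

theorem nextη_rel (j b : Fin 2) : Φ.nextη j b (Φ.rel j) = 0 := by
  have h := Φ.ratio_mul j
  obtain rfl | rfl := eq_or_eq_add_one j b
  · simp [nextη_self, rel, Φ.η_X, (add_one_ne _).symm]
    linear_combination (-Polynomial.X) * h
  · simp [nextη_add_one, rel, Φ.η_X]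
    linear_combination (-Polynomial.C (Φ.X j)) * h

theorem nextη_J (j b : Fin 2) : ∀ a ∈ Φ.nextJ j, Φ.nextη j b a ∈ Φ.nextJ j := by
  refine derivation_mem_sup_span _ (derivation_mem_of_map _ _ le_sup_left ?_)
    Φ.rel_mem_nextJ (by rw [nextη_rel]; exact zero_mem _)
  intro a ha
  have h1 := Φ.C_mem_nextJ (j := j) (Φ.η_J j a ha)
  have h2 := Φ.C_mem_nextJ (j := j) (Φ.η_J (j + 1) a ha)
  obtain rfl | rfl := eq_or_eq_add_one j b
  · rw [nextη_self, coeffDer_C, coeffDer_C]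
    exact add_mem h1 (Ideal.mul_mem_left _ _ h2)
  · rw [nextη_add_one, coeffDer_C, varDer_C, add_zero]
    exact Ideal.mul_mem_left _ _ h2

theorem next_euler (j : Fin 2) (P : Polynomial Φ.R) : (Φ.toChart.next j).euler (Φ.nextWt j) P =
    (Φ.wt j : Polynomial Φ.R) * Polynomial.C (Φ.X j) * Φ.nextδ j j P +
      ((Φ.wt (j + 1) : Polynomial Φ.R) - (Φ.wt j : Polynomial Φ.R)) * Polynomial.X *
        Φ.nextδ j (j + 1) P := by
  rw [Chart.euler_apply _ _ j]
  simp

theorem next_euler_C (j : Fin 2) (a : Φ.R) :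
    (Φ.toChart.next j).euler (Φ.nextWt j) (Polynomial.C a) =
      Polynomial.C (Φ.euler Φ.wt a) + Φ.rel j * Polynomial.C (Φ.δ (j + 1) a) := by
  rw [next_euler, Φ.euler_apply _ j, Chart.nextδ_self_C, Chart.nextδ_add_one_C, rel]
  simp only [map_add, map_mul, map_intCast]
  ring

theorem next_euler_X (j : Fin 2) :
    (Φ.toChart.next j).euler (Φ.nextWt j) Polynomial.X =
      ((Φ.wt (j + 1) : Polynomial Φ.R) - (Φ.wt j : Polynomial Φ.R)) * Polynomial.X := by
  rw [next_euler]
  simp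

theorem next_euler_rel (j : Fin 2) :
    (Φ.toChart.next j).euler (Φ.nextWt j) (Φ.rel j) = 0 := by
  rw [next_euler, rel]
  simp only [map_mul, map_sub, Derivation.leibniz, Chart.nextδ_self_C, Chart.nextδ_self_X,
    Chart.nextδ_add_one_C, Chart.nextδ_add_one_X, smul_eq_mul, Φ.δ_X]
  simp
  ring

theorem next_euler_J (j : Fin 2) : ∀ a ∈ Φ.nextJ j,
    (Φ.toChart.next j).euler (Φ.nextWt j) a ∈ Φ.nextJ j := by
  refine derivation_mem_sup_span _ (derivation_mem_of_map _ _ le_sup_left ?_)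
    Φ.rel_mem_nextJ (by rw [next_euler_rel]; exact zero_mem _)
  intro a ha
  rw [next_euler_C]
  exact add_mem (Φ.C_mem_nextJ (Φ.euler_J a ha)) (Ideal.mul_mem_right _ _ Φ.rel_mem_nextJ)

theorem next_tt_eq_zero (z : Polynomial Φ.R →ₐ[K] K) (hz : ∀ a ∈ Φ.nextJ j, z a = 0) :
    z (Polynomial.C Φ.tt) = 0 ↔ ∃ b, z (Φ.nextX j b) = 0 := by
  rw [mem_nextJ_iff] at hz
  rw [apply_C, Φ.tt_eq_zero _ hz.1]
  have h1 := Φ.wt_cast_ne_zero j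
  have h2 := Φ.wt_cast_ne_zero (j + 1)
  have key : ∀ p : Fin 2 → Prop, (∃ b, p b) ↔ p j ∨ p (j + 1) := by
    intro p
    refine ⟨?_, fun h => h.elim (fun h => ⟨_, h⟩) fun h => ⟨_, h⟩⟩
    rintro ⟨b, hb⟩
    obtain rfl | rfl := eq_or_eq_add_one j b
    exacts [Or.inl hb, Or.inr hb]
  rw [key, key, Chart.nextX_self, Chart.nextX_add_one, apply_C]
  have h3 := hz.2
  constructor
  · rintro (h | h)
    · exact Or.inl h
    · rw [h, mul_zero] at h3
      simpa [h1] using h3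
  · rintro (h | h)
    · exact Or.inl h
    · rw [h, mul_zero] at h3
      right
      simpa [h2] using h3.symm

theorem next_unram (z : Polynomial Φ.R →ₐ[K] K) (hz : ∀ a ∈ Φ.nextJ j, z a = 0)
    (ht : z (Polynomial.C Φ.tt) ≠ 0) (d : Polynomial Φ.R →ₗ[K] K)
    (hd : ∀ a b, d (a * b) = z a * d b + z b * d a) (hdJ : ∀ a ∈ Φ.nextJ j, d a = 0)
    (hdt : d (Polynomial.C Φ.tt) = 0) :
    ∃ c, ∀ a, d a = c * z ((Φ.toChart.next j).euler (Φ.nextWt j) a) := by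
  obtain ⟨hzJ, hrel⟩ := Φ.mem_nextJ_iff.1 hz
  obtain ⟨c, hc⟩ := Φ.unram (basePt z) hzJ ht (d.comp Polynomial.CAlgHom.toLinearMap)
    (fun a b => by simpa using hd (Polynomial.C a) (Polynomial.C b))
    (fun a ha => hdJ _ (Φ.C_mem_nextJ ha)) hdt
  have hc' : ∀ a, d (Polynomial.C a) = c * basePt z (Φ.euler Φ.wt a) := hc
  refine ⟨c, fun P => ?_⟩
  refine polynomial_leibniz_ext (z := z) (d' := c • (z.toLinearMap.comp
    ((Φ.toChart.next j).euler (Φ.nextWt j)).toLinearMap)) hd ?_ ?_ ?_ P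
  · intro a b
    simp
    ring
  · intro a
    change d (Polynomial.C a) = c * z ((Φ.toChart.next j).euler (Φ.nextWt j) (Polynomial.C a))
    rw [hc', next_euler_C, map_add, map_mul, hz _ Φ.rel_mem_nextJ, zero_mul, add_zero, apply_C]
  · change d Polynomial.X = c * z ((Φ.toChart.next j).euler (Φ.nextWt j) Polynomial.X)
    have h1 := hdJ _ (Φ.rel_mem_nextJ (j := j))
    have h2 : basePt z (Φ.X j) ≠ 0 := fun h => ht ((Φ.tt_eq_zero _ hzJ).2 ⟨j, h⟩)
    rw [rel, map_sub, hd, hc', hc'] at h1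
    simp only [Derivation.leibniz, Chart.euler_X, smul_eq_mul, Derivation.map_intCast, apply_C,
      map_mul, map_intCast, mul_zero, add_zero] at h1
    rw [next_euler_X]
    simp only [map_mul, map_sub, map_intCast]
    refine mul_left_cancel₀ (mul_ne_zero (Φ.wt_cast_ne_zero j) h2) ?_
    linear_combination h1 - c * Φ.wt (j + 1) * hrel

theorem next_mem_curve (t : K) (ht : t ≠ 0) (z : Polynomial Φ.R →ₐ[K] K) :
    Φ.nextΘ j z ∈ M.lift (C t) ↔ (∀ a ∈ Φ.nextJ j, z a = 0) ∧ z (Polynomial.C Φ.tt) = t := by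
  have key : ∀ z : Polynomial Φ.R →ₐ[K] K, (Φ.Θ (basePt z) ∈ C t ∧
      M.line (Φ.nextΘ j z) = M.space.tangentTo (C t) (Φ.Θ (basePt z))) ↔
      ((∀ a ∈ Φ.nextJ j, z a = 0) ∧ z (Polynomial.C Φ.tt) = t) := by
    intro z
    rw [Φ.mem_nextJ_iff, apply_C, and_right_comm, ← Φ.mem_curve t ht]
    refine and_congr_right fun hy => ?_
    obtain ⟨e, heB, he, hspan⟩ := Φ.exists_tangentTo_eq_span ht hy
    rw [hspan, Chart.line_nextΘ]
    have hX : ∀ b, e (Φ.reg _ (Φ.X b)) = Φ.wt b * basePt z (Φ.X b) := fun b => by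
      rw [he, Chart.euler_X]
      simp
    obtain ⟨hyJ, hyt⟩ := (Φ.mem_curve t ht _).1 hy
    constructor
    · intro h
      have h1 : (Φ.frame (basePt z) j (z Polynomial.X)).1 ∈ Submodule.span K {e} := by
        rw [← h]; exact Submodule.mem_span_singleton_self _
      obtain ⟨c, hc⟩ := Submodule.mem_span_singleton.1 h1
      have h2 := Φ.frame_apply_X (basePt z) j (z Polynomial.X)
      have h3 := Φ.frame_apply_X_add_one (basePt z) j (z Polynomial.X)
      rw [← hc, LinearMap.smul_apply, hX, smul_eq_mul] at h2 h3
      rw [← h3]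
      linear_combination (Φ.wt (j + 1) * basePt z (Φ.X (j + 1))) * h2
    · intro h
      have h1 := Φ.eq_smul_frame heB (j := j) (c := z Polynomial.X) (by rw [hX, hX, h])
      rw [h1]
      refine (Submodule.span_singleton_smul_eq (IsUnit.mk0 _ ?_) _).symm
      rw [hX]
      exact mul_ne_zero (Φ.wt_cast_ne_zero j) fun h => by
        rw [(Φ.tt_eq_zero _ hyJ).2 ⟨j, h⟩] at hyt
        exact ht hyt.symm
  constructor
  · intro h
    have hcl : ∀ P : Polynomial Φ.R, (∀ z : Polynomial Φ.R →ₐ[K] K,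
        ((∀ a ∈ Φ.nextJ j, z a = 0) ∧ z (Polynomial.C Φ.tt) = t) → z P = 0) → z P = 0 := by
      intro P hP
      by_contra h0
      obtain ⟨z', hz', hz0⟩ := exists_of_mem_closure (Φ := Φ.nextAffine j) h h0
      exact hz0 (hP z' ((key z').1 hz'))
    refine ⟨fun a ha => hcl a fun z hz => hz.1 a ha, ?_⟩
    have := hcl (Polynomial.C Φ.tt - algebraMap K _ t) fun z hz => by
      rw [map_sub, hz.2, AlgHom.commutes]; simp
    rwa [map_sub, AlgHom.commutes, sub_eq_zero] at this
  · intro h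
    exact subset_closure ((key z).2 h)

variable (j)

/-- The chart of the prolongation of a family on which the `j`th coordinate is retained. -/
abbrev next : FamChart.{u, v} M.next (fun t => M.lift (C t)) where
  toChart := Φ.toChart.next j
  wt := Φ.nextWt j
  wt_pos := by
    have := Φ.wt_pos
    have := Φ.wt_neg
    fin_cases j <;> simp [nextWt] <;> omega
  wt_neg := by
    have := Φ.wt_pos
    have := Φ.wt_neg
    fin_cases j <;> simp [nextWt] <;> omega
  J := Φ.nextJ j
  tt := Polynomial.C Φ.tt
  η := Φ.nextη j
  η_X := Φ.nextη_nextX j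
  η_J := Φ.nextη_J j
  euler_J := Φ.next_euler_J j
  euler_tt := by
    rw [next_euler_C]
    exact add_mem (Φ.C_mem_nextJ Φ.euler_tt) (Ideal.mul_mem_right _ _ Φ.rel_mem_nextJ)
  unram := Φ.next_unram
  tt_eq_zero := Φ.next_tt_eq_zero
  mem_curve := Φ.next_mem_curve

end FamChart

theorem apply_eq_coeff_zero {K : Type u} [Field K] {R : Type v} [CommRing R] [Algebra K R]
    {z : Polynomial R →ₐ[K] K} (hz : z Polynomial.X = 0) (P : Polynomial R) :
    z P = basePt z (P.coeff 0) := by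
  conv_lhs => rw [← P.divX_mul_X_add]
  simp [hz]

theorem apply_eq_eval_map {K : Type u} [Field K] {R : Type v} [CommRing R] [Algebra K R]
    (z : Polynomial R →ₐ[K] K) (P : Polynomial R) :
    z P = (P.map (basePt z : R →+* K)).eval (z Polynomial.X) := by
  conv_lhs => rw [← extPt_basePt z]
  rw [Polynomial.eval_map]
  rfl

theorem AffineChart.isPreirreducible_image {K : Type u} [Field K] {S : FunSpace.{u, max u v} K}
    (Φ : AffineChart.{u, v} S) {W : Set (Φ.R →ₐ[K] K)}
    (hW : ∀ b b', (∃ z ∈ W, z b ≠ 0) → (∃ z ∈ W, z b' ≠ 0) → ∃ z ∈ W, z b ≠ 0 ∧ z b' ≠ 0) :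
    IsPreirreducible (Φ.Θ '' W) := by
  rintro U V hU hV ⟨_, ⟨y, hy, rfl⟩, hyU⟩ ⟨_, ⟨y', hy', rfl⟩, hyV⟩
  obtain ⟨b, hb, H⟩ := exists_of_eventually (hU.mem_nhds hyU)
  obtain ⟨b', hb', H'⟩ := exists_of_eventually (hV.mem_nhds hyV)
  obtain ⟨z, hz, hzb, hzb'⟩ := hW b b' ⟨y, hy, hb⟩ ⟨y', hy', hb'⟩
  exact ⟨_, ⟨z, hz, rfl⟩, H z hzb, H' z hzb'⟩

namespace Distribution

variable {K : Type u} [Field K] {M : Distribution.{u, max u v} K}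

/-- The projection from the projectivization. -/
def fst (M : Distribution.{u, max u v} K) (r : M.next.space.carrier) : M.space.carrier :=
  Sigma.fst (β := fun x => ℙ K (M.B x)) r

theorem continuous_fst' : Continuous (fst M) := continuous_fst

/-- The lift of a nonsingular curve. -/
def tangentLift (M : Distribution.{u, max u v} K) (Z : Set M.space.carrier) :
    Set M.next.space.carrier :=
  {r | M.fst r ∈ Z ∧ M.line r = M.space.tangentTo Z (M.fst r)}

theorem tangentLift_injOn (Z : Set M.space.carrier) : Set.InjOn (fst M) (M.tangentLift Z) := by
  rintro ⟨x, ℓ⟩ ⟨-, h⟩ ⟨x', ℓ'⟩ ⟨-, h'⟩ (rfl : x = x')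
  exact points_ext rfl (heq_of_eq (h.trans h'.symm))

end Distribution

namespace Chart

variable {K : Type u} [Field K] {M : Distribution.{u, max u v} K}
  (Φ : Chart.{u, v} M)

/-- In the chart, the set `Z` is contained in the zero locus of the `i`th coordinate, and it is a
nonsingular curve whose tangent lines lie in the distribution. -/
def IsAxis (Z : Set M.space.carrier) (i : Fin 2) : Prop :=
  ∀ y, Φ.Θ y ∈ Z → y (Φ.X i) = 0 ∧
    ∀ w, w ∈ M.space.tangentTo Z (Φ.Θ y) ↔ w ∈ M.B (Φ.Θ y) ∧ w (Φ.reg y (Φ.X i)) = 0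

theorem exists_dir_ne_zero {y : Φ.R →ₐ[K] K} (ℓ : ℙ K (M.B (Φ.Θ y))) :
    ∃ b, M.dir ⟨Φ.Θ y, ℓ⟩ (Φ.reg y (Φ.X b)) ≠ 0 := by
  by_contra! h
  exact M.dir_ne_zero ⟨Φ.Θ y, ℓ⟩
    (B_ext (w := M.dir ⟨Φ.Θ y, ℓ⟩) (w' := 0) (M.dir_mem ⟨Φ.Θ y, ℓ⟩) (zero_mem _) fun b => h b)

variable [IsAlgClosed K] [CharZero K] {Φ} {Z : Set M.space.carrier} {j : Fin 2}

theorem IsAxis.tangentTo_eq (h : Φ.IsAxis Z (j + 1)) {y : Φ.R →ₐ[K] K} (hy : Φ.Θ y ∈ Z) :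
    M.space.tangentTo Z (Φ.Θ y) = Submodule.span K {(Φ.frame y j 0).1} := by
  ext w
  rw [(h y hy).2, Submodule.mem_span_singleton]
  constructor
  · rintro ⟨hw, h0⟩
    exact ⟨_, (Φ.eq_smul_frame hw (by rw [h0, mul_zero])).symm⟩
  · rintro ⟨c, rfl⟩
    refine ⟨Submodule.smul_mem _ _ (Φ.frame y j 0).2, ?_⟩
    rw [LinearMap.smul_apply, frame_apply_X_add_one, smul_zero]

theorem IsAxis.nextΘ_mem_tangentLift (h : Φ.IsAxis Z (j + 1)) {z : Polynomial Φ.R →ₐ[K] K} :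
    Φ.nextΘ j z ∈ M.tangentLift Z ↔ Φ.Θ (basePt z) ∈ Z ∧ z Polynomial.X = 0 := by
  change Φ.Θ (basePt z) ∈ Z ∧ M.line (Φ.nextΘ j z) = M.space.tangentTo Z (Φ.Θ (basePt z)) ↔ _
  refine and_congr_right fun hz => ?_
  rw [h.tangentTo_eq hz, line_nextΘ]
  constructor
  · intro h'
    have h1 : (Φ.frame (basePt z) j (z Polynomial.X)).1 ∈
        Submodule.span K {(Φ.frame (basePt z) j 0).1} := by
      rw [← h']; exact Submodule.mem_span_singleton_self _
    obtain ⟨c, hc⟩ := Submodule.mem_span_singleton.1 h1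
    rw [← Φ.frame_apply_X_add_one (basePt z) j (z Polynomial.X), ← hc, LinearMap.smul_apply,
      frame_apply_X_add_one, smul_zero]
  · intro h'
    rw [h']

theorem IsAxis.mem_range_of_mem_tangentLift (h : Φ.IsAxis Z (j + 1)) {r : M.next.space.carrier}
    (hr : r ∈ M.tangentLift Z) (hr' : M.fst r ∈ Set.range Φ.Θ) : r ∈ Set.range (Φ.nextΘ j) := by
  obtain ⟨x, ℓ⟩ := r
  obtain ⟨y, hy⟩ := hr'
  change Φ.Θ y = x at hy
  subst hy
  obtain ⟨hZ, hline⟩ := hr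
  have h1 : M.dir ⟨Φ.Θ y, ℓ⟩ ∈ M.space.tangentTo Z (Φ.Θ y) := by
    change M.dir ⟨Φ.Θ y, ℓ⟩ ∈ M.space.tangentTo Z (M.fst ⟨Φ.Θ y, ℓ⟩)
    rw [← hline, line_eq_span]
    exact Submodule.mem_span_singleton_self _
  obtain ⟨hB, h0⟩ := ((h y hZ).2 _).1 h1
  refine Φ.mem_range_nextΘ.2 ⟨⟨y, rfl⟩, fun h2 => ?_⟩
  rw [dirDeriv_eq _ (Φ.ext_mem_regAt _ _)] at h2
  obtain ⟨b, hb⟩ := Φ.exists_dir_ne_zero ℓ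
  obtain rfl | rfl := eq_or_eq_add_one j b
  · exact hb h2
  · exact hb h0

theorem IsAxis.exists_of_mem_tangentLift (h : Φ.IsAxis Z (j + 1)) {r : M.next.space.carrier}
    (hr : r ∈ M.tangentLift Z) {y : Φ.R →ₐ[K] K} (hr' : M.fst r = Φ.Θ y) :
    r = Φ.nextΘ j (extPt y 0) := by
  obtain ⟨z, rfl⟩ := h.mem_range_of_mem_tangentLift hr ⟨y, hr'.symm⟩
  have h1 : basePt z = y := Φ.injective hr'
  have h2 := (h.nextΘ_mem_tangentLift.1 hr).2
  rw [← h1, ← h2, extPt_basePt]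

theorem IsAxis.nextΘ_extPt_mem (h : Φ.IsAxis Z (j + 1)) {y : Φ.R →ₐ[K] K} (hy : Φ.Θ y ∈ Z) :
    Φ.nextΘ j (extPt y 0) ∈ M.tangentLift Z :=
  h.nextΘ_mem_tangentLift.2 ⟨by rwa [basePt_extPt], by simp⟩

theorem IsAxis.next (h : Φ.IsAxis Z (j + 1)) : (Φ.next j).IsAxis (M.tangentLift Z) (j + 1) := by
  intro z hz
  obtain ⟨hzZ, hzX⟩ := h.nextΘ_mem_tangentLift.1 hz
  have hline : M.line (Φ.nextΘ j z) = M.space.tangentTo Z (Φ.Θ (basePt z)) := hz.2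
  refine ⟨by simpa using hzX, fun w => ?_⟩
  have hY : (Φ.next j).X (j + 1) = Polynomial.X := Φ.nextX_add_one j
  rw [hY]
  constructor
  · intro hw
    have hw' := (mem_tangentTo_iff (Φ := (Φ.next j).toAffineChart) hz hw.1).1 hw
    refine ⟨(mem_next_B hw.1).2 ?_, hw' Polynomial.X 1 (by simp) fun z' hz' _ =>
      (h.nextΘ_mem_tangentLift.1 hz').2⟩
    rw [hline, mem_tangentTo_iff hzZ (dproj_mem_tangent hw.1)]
    intro a b hb hab
    rw [← Φ.nextAffine_reg_C j z hw.1]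
    exact hw' (Polynomial.C a) (Polynomial.C b) hb fun z' hz' hz'b =>
      hab _ (h.nextΘ_mem_tangentLift.1 hz').1 hz'b
  · rintro ⟨hw, hwX⟩
    have hwt := (Φ.next j).B_le _ hw
    refine (mem_tangentTo_iff (Φ := (Φ.next j).toAffineChart) hz hwt).2 fun P Q hQ hPQ => ?_
    have h1 : w ((Φ.nextAffine j).reg z P) =
        M.dproj (Φ.nextΘ j z) w (Φ.reg (basePt z) (P.coeff 0)) := by
      rw [← Φ.nextAffine_reg_C j z hwt]
      conv_lhs => rw [← P.divX_mul_X_add]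
      rw [map_add, map_add, pull_mul (Φ := Φ.nextAffine j) hwt, hwX, hzX]
      rw [mul_zero, zero_mul, zero_add, zero_add]
      rfl
    refine h1.trans ?_
    have h2 : M.dproj (Φ.nextΘ j z) w ∈ M.space.tangentTo Z (Φ.Θ (basePt z)) := by
      rw [← hline]
      exact (mem_next_B hwt).1 hw
    refine (mem_tangentTo_iff hzZ h2.1).1 h2 _ (Q.coeff 0) ?_ fun y hy hyQ => ?_
    · rwa [← apply_eq_coeff_zero hzX]
    · have h3 := hPQ (extPt y 0) (h.nextΘ_extPt_mem hy)
      rw [apply_eq_coeff_zero (extPt_X y 0), apply_eq_coeff_zero (extPt_X y 0), basePt_extPt] at h3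
      exact h3 hyQ

theorem isAxis_fiber {y : Φ.R →ₐ[K] K} (hy : y (Φ.X j) = 0) :
    (Φ.next j).IsAxis (M.fst ⁻¹' {Φ.Θ y}) j := by
  have hmem : ∀ z : Polynomial Φ.R →ₐ[K] K, Φ.nextΘ j z ∈ M.fst ⁻¹' {Φ.Θ y} ↔ basePt z = y :=
    fun z => ⟨fun h => Φ.injective h, fun h => congrArg Φ.Θ h⟩
  intro z hz
  have hzy := (hmem z).1 hz
  have hX : (Φ.next j).X j = Polynomial.C (Φ.X j) := Φ.nextX_self j
  rw [hX]
  refine ⟨by rw [apply_C, hzy, hy], fun w => ?_⟩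
  constructor
  · intro hw
    have hw' := (mem_tangentTo_iff (Φ := (Φ.next j).toAffineChart) hz hw.1).1 hw
    have hC : ∀ a, w ((Φ.nextAffine j).reg z (Polynomial.C a)) = 0 := by
      intro a
      have h1 : w ((Φ.nextAffine j).reg z 1) = 0 := by
        simpa using pull_mul (Φ := Φ.nextAffine j) hw.1 1 1
      have h2 := hw' (Polynomial.C a - y a • 1) 1 (by simp) fun z' hz' _ => by
        rw [map_sub, apply_C, (hmem z').1 hz']
        simp
      rw [map_sub, map_sub, map_smul, map_smul, h1, smul_zero, sub_zero] at h2
      exact h2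
    refine ⟨(mem_next_B hw.1).2 ?_, hC _⟩
    have h0 : M.dproj (Φ.nextΘ j z) w = 0 :=
      tangent_ext (Φ := Φ.toAffineChart) (dproj_mem_tangent hw.1) (zero_mem _) fun a =>
        (Φ.nextAffine_reg_C j z hw.1 a).symm.trans (hC a)
    rw [h0]
    exact zero_mem _
  · rintro ⟨hw, hwX⟩
    have hwt := (Φ.next j).B_le _ hw
    refine (mem_tangentTo_iff (Φ := (Φ.next j).toAffineChart) hz hwt).2 fun P Q hQ hPQ => ?_
    refine ((mem_B_iff hwt).1 hw P).trans ?_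
    rw [sum_fin_two' j, hX, hwX, zero_mul, zero_add]
    have hP : P.map (y : Φ.R →+* K) = 0 := by
      have hQ0 : Q.map (y : Φ.R →+* K) ≠ 0 := by
        intro h0
        rw [apply_eq_eval_map, hzy, h0, Polynomial.eval_zero] at hQ
        exact hQ rfl
      refine (mul_eq_zero.1 (Polynomial.funext (q := 0) fun c => ?_)).resolve_right hQ0
      have h1 := hPQ (extPt y c) ((hmem _).2 (basePt_extPt y c))
      rw [apply_eq_eval_map, apply_eq_eval_map _ P, basePt_extPt, extPt_X] at h1
      rw [Polynomial.eval_mul, Polynomial.eval_zero, mul_eq_zero]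
      tauto
    have h2 : z ((Φ.next j).δ (j + 1) P) = 0 := by
      have : (Φ.next j).δ (j + 1) P = Polynomial.derivative P := by
        simp only [nextδ, add_one_ne, if_false]
        rfl
      rw [this, apply_eq_eval_map, hzy, ← Polynomial.derivative_map, hP]
      simp
    rw [h2, mul_zero]

theorem isIrreducible_fiber (Φ : Chart.{u, v} M) (y : Φ.R →ₐ[K] K) :
    IsIrreducible (M.fst ⁻¹' {Φ.Θ y}) := by
  set F : Set M.next.space.carrier := M.fst ⁻¹' {Φ.Θ y} with hF
  have hmem : ∀ (j : Fin 2) (z : Polynomial Φ.R →ₐ[K] K), Φ.nextΘ j z ∈ F ↔ basePt z = y :=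
    fun j z => ⟨fun h => Φ.injective h, fun h => congrArg Φ.Θ h⟩
  let W : Set (Polynomial Φ.R →ₐ[K] K) := {z | basePt z = y}
  have hirr : ∀ j, IsPreirreducible ((Φ.nextAffine j).Θ '' W) := by
    intro j
    refine (Φ.nextAffine j).isPreirreducible_image ?_
    rintro b b' ⟨z, hz, hzb⟩ ⟨z', hz', hzb'⟩
    change basePt z = y at hz
    change basePt z' = y at hz'
    rw [apply_eq_eval_map, hz] at hzb
    rw [apply_eq_eval_map, hz'] at hzb'
    have h0 : b.map (y : Φ.R →+* K) * b'.map (y : Φ.R →+* K) ≠ 0 := by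
      refine mul_ne_zero ?_ ?_
      · intro h; rw [h, Polynomial.eval_zero] at hzb; exact hzb rfl
      · intro h; rw [h, Polynomial.eval_zero] at hzb'; exact hzb' rfl
    obtain ⟨c, hc⟩ : ∃ c : K, (b.map (y : Φ.R →+* K) * b'.map (y : Φ.R →+* K)).eval c ≠ 0 := by
      by_contra! h
      exact h0 (Polynomial.funext fun c => by rw [h, Polynomial.eval_zero])
    rw [Polynomial.eval_mul, mul_ne_zero_iff] at hc
    refine ⟨extPt y c, basePt_extPt y c, ?_⟩
    rw [apply_eq_eval_map, apply_eq_eval_map _ b', basePt_extPt, extPt_X]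
    exact hc
  have hcover : ∀ r ∈ F, ∃ j, r ∈ (Φ.nextAffine j).Θ '' W := by
    rintro ⟨x, ℓ⟩ (rfl : x = Φ.Θ y)
    have : ∃ j, (⟨Φ.Θ y, ℓ⟩ : M.Points) ∈ Set.range (Φ.nextΘ j) := by
      obtain ⟨b, h'⟩ := Φ.exists_dir_ne_zero ℓ
      refine ⟨b, Φ.mem_range_nextΘ.2 ⟨⟨y, rfl⟩, ?_⟩⟩
      rw [dirDeriv_eq _ (Φ.ext_mem_regAt _ _)]
      exact h'
    obtain ⟨j, z, hz⟩ := this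
    refine ⟨j, z, (hmem j z).1 ?_, hz⟩
    rw [hz]
    rfl
  have hmeet : ∀ j j' (U : Set M.next.space.carrier), IsOpen U →
      ((Φ.nextAffine j).Θ '' W ∩ U).Nonempty → ((Φ.nextAffine j').Θ '' W ∩ U).Nonempty := by
    intro j j' U hU hne
    obtain rfl | rfl := eq_or_eq_add_one j j'
    · exact hne
    have h1 : Φ.nextΘ j (extPt y 1) ∈ Set.range (Φ.nextΘ (j + 1)) := by
      refine Φ.mem_range_nextΘ.2 ⟨⟨_, rfl⟩, ?_⟩
      obtain ⟨c, hc, h⟩ := Φ.exists_dir_nextΘ j (extPt y 1)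
      rw [h, dirDeriv_smul, dirDeriv_eq _ (Φ.ext_mem_regAt _ _)]
      refine mul_ne_zero hc ?_
      refine (Φ.frame_apply_X_add_one _ _ _).trans_ne ?_
      simp
    obtain ⟨r, ⟨z, hz, rfl⟩, hrU, z', hz'⟩ := hirr j U (Set.range (Φ.nextΘ (j + 1))) hU
      Φ.isOpen_range_nextΘ hne ⟨_, ⟨extPt y 1, basePt_extPt y 1, rfl⟩, h1⟩
    refine ⟨_, ⟨z', (hmem (j + 1) z').1 ?_, rfl⟩, ?_⟩
    · rw [hz']
      exact (hmem j z).2 hz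
    · change Φ.nextΘ (j + 1) z' ∈ U
      rwa [hz']
  have hsub : ∀ j, (Φ.nextAffine j).Θ '' W ⊆ F := by
    rintro j _ ⟨z, hz, rfl⟩
    exact (hmem j z).2 hz
  refine ⟨⟨_, (hmem 0 (extPt y 0)).2 (basePt_extPt y 0)⟩, ?_⟩
  rintro U V hU hV ⟨r, hr, hrU⟩ ⟨s, hs, hsV⟩
  obtain ⟨j, hj⟩ := hcover r hr
  obtain ⟨j', hj'⟩ := hcover s hs
  obtain ⟨q, hq, hqU⟩ := hirr j' U V hU hV (hmeet j j' U hU ⟨r, hj, hrU⟩) ⟨s, hj', hsV⟩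
  exact ⟨q, hsub j' hq, hqU⟩

end Chart

/-- A closed set which is covered by charts in which it is an axis. -/
structure Axial {K : Type u} [Field K] (M : Distribution.{u, max u v} K)
    (Z : Set M.space.carrier) : Prop where
  isClosed : IsClosed Z
  exists_chart : ∀ q ∈ Z, ∃ (Φ : Chart.{u, v} M) (j : Fin 2), q ∈ Set.range Φ.Θ ∧
    Φ.IsAxis Z (j + 1)

namespace Axial

variable {K : Type u} [Field K] [IsAlgClosed K] [CharZero K] {M : Distribution.{u, max u v} K}
  {Z : Set M.space.carrier}

theorem image_tangentLift (hZ : Axial.{u, v} M Z) : M.fst '' M.tangentLift Z = Z := by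
  ext q
  constructor
  · rintro ⟨r, hr, rfl⟩
    exact hr.1
  · intro hq
    obtain ⟨Φ, j, ⟨y, rfl⟩, h⟩ := hZ.exists_chart q hq
    exact ⟨_, h.nextΘ_extPt_mem hq, congrArg Φ.Θ (basePt_extPt y 0)⟩

theorem tangentLift (hZ : Axial.{u, v} M Z) : Axial.{u, v} M.next (M.tangentLift Z) where
  isClosed := by
    rw [← isOpen_compl_iff, isOpen_iff_mem_nhds]
    intro r hr
    by_cases hrZ : M.fst r ∈ Z
    · obtain ⟨Φ, j, hrΦ, h⟩ := hZ.exists_chart _ hrZ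
      have hr' : r ∈ Set.range (Φ.nextΘ (j + 1)) := by
        refine Φ.mem_range_nextΘ.2 ⟨hrΦ, fun h0 => hr ?_⟩
        obtain ⟨x, ℓ⟩ := r
        obtain ⟨y, hy⟩ := hrΦ
        change Φ.Θ y = x at hy
        subst hy
        rw [dirDeriv_eq _ (Φ.ext_mem_regAt _ _)] at h0
        have h1 : M.dir ⟨Φ.Θ y, ℓ⟩ (Φ.reg y (Φ.X j)) ≠ 0 := by
          obtain ⟨b, hb⟩ := Φ.exists_dir_ne_zero ℓ
          obtain rfl | rfl := eq_or_eq_add_one j b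
          exacts [hb, absurd h0 hb]
        have h2 := Φ.eq_nextΘ h1
        have h3 : M.dir ⟨Φ.Θ y, ℓ⟩ (Φ.reg y (Φ.X (j + 1))) = 0 := h0
        rw [h3, zero_div] at h2
        rw [h2]
        exact h.nextΘ_extPt_mem hrZ
      filter_upwards [Φ.isOpen_range_nextΘ.mem_nhds hr']
      rintro _ ⟨z, rfl⟩ hz
      have h1 := h.exists_of_mem_tangentLift hz (y := basePt z) rfl
      have h2 := ((Φ.mem_range_nextΘ (j := j + 1)).1 ⟨z, rfl⟩).2
      obtain ⟨c, hc, h3⟩ := Φ.exists_dir_nextΘ j (extPt (basePt z) 0)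
      rw [h1, h3, dirDeriv_smul, dirDeriv_eq _ (Φ.ext_mem_regAt _ _)] at h2
      refine h2 ?_
      rw [mul_eq_zero]
      exact Or.inr ((Φ.frame_apply_X_add_one _ _ _).trans (extPt_X _ _))
    · exact Filter.mem_of_superset
        ((hZ.isClosed.isOpen_compl.preimage continuous_fst').mem_nhds hrZ)
        fun s hs hs' => hs hs'.1
  exists_chart r hr := by
    obtain ⟨Φ, j, hrΦ, h⟩ := hZ.exists_chart _ hr.1
    exact ⟨Φ.next j, j, h.mem_range_of_mem_tangentLift hr hrΦ, h.next⟩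

theorem isMorphismOn_fst (W : Set M.next.space.carrier) :
    IsMorphismOn (X := M.next.space) (Y := M.space) M.fst W :=
  ⟨continuous_fst'.continuousOn, fun r _ g hg =>
    ⟨_, M.comp_fst_mem_regAt r ⟨g, hg⟩, Filter.Eventually.of_forall fun _ => rfl⟩⟩

theorem exists_section (hZ : Axial.{u, v} M Z) (hne : Z.Nonempty) :
    ∃ ψ : M.space.carrier → M.next.space.carrier,
      IsMorphismOn (X := M.space) (Y := M.next.space) ψ Z
      ∧ Set.MapsTo ψ Z (M.tangentLift Z) ∧ Set.InvOn ψ M.fst (M.tangentLift Z) Z := by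
  classical
  have hsurj : ∀ q ∈ Z, ∃ r ∈ M.tangentLift Z, M.fst r = q := fun q hq => by
    rw [← hZ.image_tangentLift] at hq
    exact hq
  obtain ⟨q₀, hq₀⟩ := hne
  obtain ⟨r₀, -, -⟩ := hsurj q₀ hq₀
  have : Nonempty M.next.space.carrier := ⟨r₀⟩
  choose! ψ hψ hψ' using hsurj
  have hloc : ∀ {Φ : Chart.{u, v} M} {j}, Φ.IsAxis Z (j + 1) → ∀ y, Φ.Θ y ∈ Z →
      ψ (Φ.Θ y) = Φ.nextΘ j (extPt y 0) := fun h y hy =>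
    h.exists_of_mem_tangentLift (hψ _ hy) (hψ' _ hy)
  refine ⟨ψ, ⟨?_, ?_⟩, hψ, fun r hr => tangentLift_injOn Z (hψ _ hr.1) hr (hψ' _ hr.1), hψ'⟩
  · intro q hq U hU
    obtain ⟨Φ, j, ⟨y, rfl⟩, h⟩ := hZ.exists_chart q hq
    rw [hloc h y hq] at hU
    obtain ⟨b, hb, H⟩ := exists_of_eventually (Φ := Φ.nextAffine j) hU
    rw [apply_eq_coeff_zero (extPt_X y 0), basePt_extPt] at hb
    refine eventually_nhdsWithin_iff.2 (eventually_of_forall hb fun z hz hzZ => ?_)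
    rw [hloc h z hzZ]
    refine H _ ?_
    rwa [apply_eq_coeff_zero (extPt_X z 0), basePt_extPt]
  · intro q hq g hg
    obtain ⟨Φ, j, ⟨y, rfl⟩, h⟩ := hZ.exists_chart q hq
    rw [hloc h y hq] at hg
    obtain ⟨a, b, hb, H⟩ := exists_fraction_of_mem_regAt (Φ := Φ.nextAffine j) hg
    rw [apply_eq_coeff_zero (extPt_X y 0), basePt_extPt] at hb
    refine ⟨fun q => Φ.ext (a.coeff 0) q * (Φ.ext (b.coeff 0) q)⁻¹, mul_mem (Φ.ext_mem_regAt _ y)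
      (regAt_inv (Φ.ext_mem_regAt _ y) (by simpa using hb)), ?_⟩
    refine eventually_nhdsWithin_iff.2 (eventually_of_forall hb fun z hz hzZ => ?_)
    rw [hloc h z hzZ]
    refine (H _ ?_).trans ?_
    · rwa [apply_eq_coeff_zero (extPt_X z 0), basePt_extPt]
    · rw [apply_eq_coeff_zero (extPt_X z 0), apply_eq_coeff_zero (extPt_X z 0), basePt_extPt]
      simp only [ext_apply, div_eq_mul_inv]

theorem isIsomorphismOn (hZ : Axial.{u, v} M Z) (hne : Z.Nonempty) :
    IsIsomorphismOn (X := M.next.space) (Y := M.space) M.fst (M.tangentLift Z) Z := by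
  obtain ⟨ψ, h1, h2, h3⟩ := hZ.exists_section hne
  exact ⟨isMorphismOn_fst _, fun r hr => hr.1, ψ, h1, h2, h3⟩

theorem isIrreducible_tangentLift (hZ : Axial.{u, v} M Z) (hirr : IsIrreducible Z) :
    IsIrreducible (M.tangentLift Z) := by
  obtain ⟨ψ, h1, h2, h3⟩ := hZ.exists_section hirr.nonempty
  have : M.tangentLift Z = ψ '' Z :=
    Set.Subset.antisymm (fun r hr => ⟨M.fst r, hr.1, h3.1 hr⟩) (Set.image_subset_iff.2 h2)
  rw [this]
  exact hirr.image ψ h1.1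

theorem fiber (Φ : Chart.{u, v} M) {y : Φ.R →ₐ[K] K} (hy : ∀ b, y (Φ.X b) = 0)
    (hcl : IsClosed {Φ.Θ y}) : Axial.{u, v} M.next (M.fst ⁻¹' {Φ.Θ y}) where
  isClosed := hcl.preimage continuous_fst'
  exists_chart := by
    rintro ⟨x, ℓ⟩ (rfl : x = Φ.Θ y)
    have : ∃ j, (⟨Φ.Θ y, ℓ⟩ : M.Points) ∈ Set.range (Φ.nextΘ (j + 1)) := by
      obtain ⟨b, h'⟩ := Φ.exists_dir_ne_zero ℓ
      refine ⟨b + 1, Φ.mem_range_nextΘ.2 ⟨⟨y, rfl⟩, ?_⟩⟩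
      rw [add_one_add_one]
      rw [dirDeriv_eq _ (Φ.ext_mem_regAt _ _)]
      exact h'
    obtain ⟨j, hj⟩ := this
    exact ⟨Φ.next (j + 1), j, hj, Chart.isAxis_fiber (hy _)⟩

end Axial

/-- A chart of a family with an origin `pt`, through which pass the closures `Tw b` of the
components of the zero loci of the coordinates `X b` on the total space of the family. -/
structure NodeChart {K : Type u} [Field K] (M : Distribution.{u, max u v} K)
    (C : K → Set M.space.carrier) extends FamChart.{u, v} M C where
  pt : R →ₐ[K] K
  pt_X : ∀ b, pt (X b) = 0
  pt_J : ∀ a ∈ J, pt a = 0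
  isClosed_pt : IsClosed {Θ pt}
  Tw : Fin 2 → Set M.space.carrier
  axial : ∀ b, Axial.{u, v} M (Tw b)
  irred : ∀ b, IsIrreducible (Tw b)
  isAxis : ∀ b, toChart.IsAxis (Tw b) b
  Tw_J : ∀ b y, Θ y ∈ Tw b → ∀ a ∈ J, y a = 0
  pt_mem : ∀ b, Θ pt ∈ Tw b
  exists_ne : ∀ b, ∃ y, Θ y ∈ Tw b ∧ y (X (b + 1)) ≠ 0
  e : R
  pt_e : pt e ≠ 0
  near : ∀ y : R →ₐ[K] K, (∀ a ∈ J, y a = 0) → y e ≠ 0 →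
    (∀ b, y (X b) = 0 → Θ y ∈ Tw b) ∧ ((∀ b, y (X b) = 0) → y = pt)

namespace NodeChart

section Next

variable {K : Type u} [Field K] [IsAlgClosed K] [CharZero K] {M : Distribution.{u, max u v} K}
  {C : K → Set M.space.carrier} (Φ : NodeChart.{u, v} M C) (j : Fin 2)

/-- The twigs on the next level: the fibre over the origin and the lift of the twig on which the
retained coordinate does not vanish. -/
def nextTw (b : Fin 2) : Set M.next.space.carrier :=
  if b = j then M.fst ⁻¹' {Φ.Θ Φ.pt} else M.tangentLift (Φ.Tw (j + 1))

@[simp] theorem nextTw_self : Φ.nextTw j j = M.fst ⁻¹' {Φ.Θ Φ.pt} := if_pos rfl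

@[simp] theorem nextTw_add_one : Φ.nextTw j (j + 1) = M.tangentLift (Φ.Tw (j + 1)) :=
  if_neg (add_one_ne j)

theorem nextΘ_mem_fiber {j : Fin 2} {z : Polynomial Φ.R →ₐ[K] K} :
    Φ.nextΘ j z ∈ M.fst ⁻¹' {Φ.Θ Φ.pt} ↔ basePt z = Φ.pt :=
  ⟨fun h => Φ.injective h, fun h => congrArg Φ.Θ h⟩

theorem isClosed_nextΘ_pt : IsClosed {Φ.nextΘ j (extPt Φ.pt 0)} := by
  rw [← isOpen_compl_iff, isOpen_iff_mem_nhds]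
  intro r hr
  by_cases hrj : r ∈ Set.range (Φ.nextΘ j)
  · obtain ⟨z, rfl⟩ := hrj
    have hne : z ≠ extPt Φ.pt 0 := fun h => hr (by rw [h]; rfl)
    obtain ⟨P, hP⟩ := DFunLike.ne_iff.1 hne
    refine eventually_of_forall (Φ := Φ.nextAffine j) (y := z)
      (b := P - algebraMap K _ (extPt Φ.pt 0 P)) ?_ fun z' hz' h => hz' ?_
    · rw [map_sub, AlgHom.commutes]
      exact sub_ne_zero.2 hP
    · rw [Φ.nextΘ_injective h, map_sub, AlgHom.commutes]
      exact sub_self _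
  by_cases hrpt : M.fst r = Φ.Θ Φ.pt
  · obtain ⟨x, ℓ⟩ := r
    change x = Φ.Θ Φ.pt at hrpt
    subst hrpt
    obtain ⟨b, hb⟩ := Φ.exists_dir_ne_zero ℓ
    have hmem : (⟨Φ.Θ Φ.pt, ℓ⟩ : M.Points) ∈ Set.range (Φ.nextΘ b) :=
      Φ.mem_range_nextΘ.2 ⟨⟨_, rfl⟩, by rwa [dirDeriv_eq _ (Φ.ext_mem_regAt _ _)]⟩
    obtain rfl | rfl := eq_or_eq_add_one j b
    · exact absurd hmem hrj
    refine Filter.mem_of_superset (Φ.isOpen_range_nextΘ.mem_nhds hmem) ?_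
    rintro _ hs rfl
    have h2 := (Φ.mem_range_nextΘ.1 hs).2
    obtain ⟨c, hc, h3⟩ := Φ.exists_dir_nextΘ j (extPt Φ.pt 0)
    rw [h3, dirDeriv_smul, dirDeriv_eq _ (Φ.ext_mem_regAt _ _)] at h2
    refine h2 ?_
    rw [mul_eq_zero]
    exact Or.inr ((Φ.frame_apply_X_add_one _ _ _).trans (extPt_X _ _))
  · refine Filter.mem_of_superset
      ((Φ.isClosed_pt.isOpen_compl.preimage continuous_fst').mem_nhds hrpt) ?_
    rintro s hs rfl
    exact hs (congrArg Φ.Θ (basePt_extPt _ _))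

theorem nextTw_isAxis (b : Fin 2) : (Φ.toChart.next j).IsAxis (Φ.nextTw j b) b := by
  obtain rfl | rfl := eq_or_eq_add_one j b
  · rw [nextTw_self]
    exact Chart.isAxis_fiber (Φ.pt_X j)
  · rw [nextTw_add_one]
    exact (Φ.isAxis _).next

theorem nextTw_J (b : Fin 2) (z : Polynomial Φ.R →ₐ[K] K) (hz : Φ.nextΘ j z ∈ Φ.nextTw j b) :
    ∀ a ∈ Φ.nextJ j, z a = 0 := by
  rw [Φ.mem_nextJ_iff]
  obtain rfl | rfl := eq_or_eq_add_one j b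
  · rw [nextTw_self, nextΘ_mem_fiber] at hz
    rw [hz, Φ.pt_X, Φ.pt_X]
    exact ⟨Φ.pt_J, by ring⟩
  · rw [nextTw_add_one, (Φ.isAxis _).nextΘ_mem_tangentLift] at hz
    refine ⟨Φ.Tw_J _ _ hz.1, ?_⟩
    rw [hz.2, (Φ.isAxis _ _ hz.1).1]
    ring

theorem nextTw_near (z : Polynomial Φ.R →ₐ[K] K) (hz : ∀ a ∈ Φ.nextJ j, z a = 0)
    (hze : z (Polynomial.C Φ.e) ≠ 0) :
    (∀ b, z (Φ.nextX j b) = 0 → Φ.nextΘ j z ∈ Φ.nextTw j b) ∧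
      ((∀ b, z (Φ.nextX j b) = 0) → z = extPt Φ.pt 0) := by
  obtain ⟨hJ, hrel⟩ := Φ.mem_nextJ_iff.1 hz
  obtain ⟨h1, h2⟩ := Φ.near _ hJ hze
  have hwt := Φ.wt_cast_ne_zero
  have hself : z (Φ.nextX j j) = 0 → basePt z = Φ.pt := by
    intro h
    rw [Chart.nextX_self, apply_C] at h
    rw [h, mul_zero, zero_mul] at hrel
    have h' := (mul_eq_zero.1 hrel.symm).resolve_left (hwt _)
    refine h2 fun b => ?_
    obtain rfl | rfl := eq_or_eq_add_one j b
    exacts [h, h']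
  refine ⟨fun b hb => ?_, fun h => ?_⟩
  · obtain rfl | rfl := eq_or_eq_add_one j b
    · rw [nextTw_self, nextΘ_mem_fiber]
      exact hself hb
    · rw [Chart.nextX_add_one] at hb
      rw [hb, mul_zero] at hrel
      rw [nextTw_add_one, (Φ.isAxis _).nextΘ_mem_tangentLift]
      exact ⟨h1 _ ((mul_eq_zero.1 hrel.symm).resolve_left (hwt _)), hb⟩
  · have hX := h (j + 1)
    rw [Chart.nextX_add_one] at hX
    rw [← hself (h j), ← hX, extPt_basePt]

/-- The chart of the next level with its origin and twigs. -/
abbrev next : NodeChart.{u, v} M.next (fun t => M.lift (C t)) where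
  toFamChart := Φ.toFamChart.next j
  pt := extPt Φ.pt 0
  pt_X b := by
    obtain rfl | rfl := eq_or_eq_add_one j b
    · simp [Φ.pt_X]
    · simp
  pt_J := Φ.mem_nextJ_iff.2 (by
    rw [basePt_extPt, Φ.pt_X, Φ.pt_X]
    exact ⟨Φ.pt_J, by ring⟩)
  isClosed_pt := Φ.isClosed_nextΘ_pt j
  Tw := Φ.nextTw j
  axial b := by
    obtain rfl | rfl := eq_or_eq_add_one j b
    · rw [nextTw_self]
      exact Axial.fiber Φ.toChart Φ.pt_X Φ.isClosed_pt
    · rw [nextTw_add_one]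
      exact (Φ.axial _).tangentLift
  irred b := by
    obtain rfl | rfl := eq_or_eq_add_one j b
    · rw [nextTw_self]
      exact Φ.isIrreducible_fiber Φ.pt
    · rw [nextTw_add_one]
      exact (Φ.axial _).isIrreducible_tangentLift (Φ.irred _)
  isAxis := Φ.nextTw_isAxis j
  Tw_J := Φ.nextTw_J j
  pt_mem b := by
    obtain rfl | rfl := eq_or_eq_add_one j b
    · rw [nextTw_self]
      exact Φ.nextΘ_mem_fiber.2 (basePt_extPt _ _)
    · rw [nextTw_add_one]
      exact (Φ.isAxis _).nextΘ_extPt_mem (Φ.pt_mem _)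
  exists_ne b := by
    obtain rfl | rfl := eq_or_eq_add_one j b
    · refine ⟨extPt Φ.pt 1, ?_, by simp⟩
      rw [nextTw_self]
      exact Φ.nextΘ_mem_fiber.2 (basePt_extPt _ _)
    · obtain ⟨y, hy, hne⟩ := Φ.exists_ne (j + 1)
      refine ⟨extPt y 0, ?_, ?_⟩
      · rw [nextTw_add_one]
        exact (Φ.isAxis _).nextΘ_extPt_mem hy
      · rw [add_one_add_one] at hne ⊢
        simpa using hne
  e := Polynomial.C Φ.e
  pt_e := by
    rw [apply_C, basePt_extPt]
    exact Φ.pt_e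
  near := Φ.nextTw_near j

end Next

/-! ### The central fibre of the family -/

section Nodal

variable {K : Type u} [Field K]

theorem _root_.Monster.FunSpace.Local.isOpen_preimage {X : FunSpace.{u, v} K}
    {Y : FunSpace.{u, w} K} {φ : X.carrier → Y.carrier}
    (hgen : ∀ D f, (D, f) ∈ Y.gen → IsOpen (φ ⁻¹' D) ∧
      ∀ x, φ x ∈ D → (fun y => f (φ y)) ∈ X.regAt x)
    {D : Set Y.carrier} {f : Y.carrier → K} (h : Y.Local D f) :
    IsOpen (φ ⁻¹' D) ∧ ∀ x, φ x ∈ D → (fun y => f (φ y)) ∈ X.regAt x := by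
  induction h with
  | gen h => exact hgen _ _ h
  | const c => exact ⟨isOpen_univ, fun x _ => const_mem_regAt c⟩
  | add _ _ ih ih' =>
    exact ⟨ih.1.inter ih'.1, fun x hx => add_mem (ih.2 x hx.1) (ih'.2 x hx.2)⟩
  | mul _ _ ih ih' =>
    exact ⟨ih.1.inter ih'.1, fun x hx => mul_mem (ih.2 x hx.1) (ih'.2 x hx.2)⟩
  | inv _ ih =>
    refine ⟨isOpen_iff_mem_nhds.2 fun x hx => ?_, fun x hx => regAt_inv (ih.2 x hx.1) hx.2⟩
    filter_upwards [ih.1.mem_nhds hx.1, eventually_ne_zero (ih.2 x hx.1) hx.2] with y h1 h2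
    exact ⟨h1, h2⟩

variable {S : FunSpace.{u, v} K} {T : Set K}

theorem local_prodLine_fst {D : Set S.carrier} {f : S.carrier → K} (h : S.Local D f) :
    (S.prodLine T).Local (Prod.fst ⁻¹' D) fun z => f z.1 :=
  Local.gen (Or.inl ⟨D, f, h, rfl⟩)

theorem continuous_prodLine_mk (t : T) :
    @Continuous S.carrier (S.prodLine T).carrier _ _ fun q => (q, t) := by
  refine continuous_generateFrom_iff.2 ?_
  rintro D ⟨f, hf⟩
  refine (hf.isOpen_preimage ?_).1
  rintro D f (⟨D, f, hf, h⟩ | h)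
  · obtain ⟨rfl, rfl⟩ := Prod.mk.inj h
    exact ⟨hf.isOpen, fun x hx => hf.mem_regAt hx⟩
  · obtain ⟨rfl, rfl⟩ := Prod.mk.inj h
    exact ⟨isOpen_univ, fun x _ => const_mem_regAt (t : K)⟩

theorem prodLine_fst_mem_regAt {f : S.carrier → K} {z : (S.prodLine T).carrier}
    (hf : f ∈ S.regAt (Prod.fst z)) :
    (fun w : (S.prodLine T).carrier => f (Prod.fst w)) ∈ (S.prodLine T).regAt z := by
  obtain ⟨D, g, hg, hz, hD⟩ := hf
  exact ⟨_, _, local_prodLine_fst hg, hz, fun w hw => hD w.1 hw⟩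

theorem prodLine_snd_mem_regAt (z : (S.prodLine T).carrier) :
    (fun w : (S.prodLine T).carrier => ((Prod.snd w : T) : K)) ∈ (S.prodLine T).regAt z := by
  have h : (S.prodLine T).Local Set.univ fun w => ((Prod.snd w : T) : K) := Local.gen (Or.inr rfl)
  exact h.mem_regAt (Set.mem_univ _)

/-- The total space of the closure of a family of curves. -/
def totalSpace (C : K → Set S.carrier) (T : Set K) : Set (S.prodLine T).carrier :=
  closure {z : (S.prodLine T).carrier | (z.2 : K) ≠ 0 ∧ z.1 ∈ C (z.2 : K)}

/-- The limit for `t = 0` of a family of curves. -/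
def centralFiber (C : K → Set S.carrier) (T : Set K) : Set S.carrier :=
  {q | ∃ h : (0 : K) ∈ T, ((q, ⟨0, h⟩) : S.carrier × T) ∈ totalSpace C T}

theorem isClosed_centralFiber (C : K → Set S.carrier) (hT0 : (0 : K) ∈ T) :
    IsClosed (centralFiber C T) := by
  have : centralFiber C T = (fun q => ((q, ⟨0, hT0⟩) : S.carrier × T)) ⁻¹' (totalSpace C T) := by
    ext q
    exact ⟨fun ⟨_, h⟩ => h, fun h => ⟨hT0, h⟩⟩
  rw [this]
  exact IsClosed.preimage (continuous_prodLine_mk _) isClosed_closure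

end Nodal

section Twigs

variable {K : Type u} [Field K] [IsAlgClosed K] [CharZero K] {M : Distribution.{u, max u v} K}
  {C : K → Set M.space.carrier} {T : Set K}

theorem _root_.Monster.FamChart.mem_centralFiber_iff (Φ : FamChart.{u, v} M C) (hT : Tᶜ.Finite)
    (hT0 : (0 : K) ∈ T) {y : Φ.R →ₐ[K] K} :
    Φ.Θ y ∈ centralFiber C T ↔ (∀ a ∈ Φ.J, y a = 0) ∧ y Φ.tt = 0 := by
  classical
  constructor
  · rintro ⟨h0, h⟩
    let p : (M.space.prodLine T).carrier := ((Φ.Θ y, ⟨0, h0⟩) : M.space.carrier × T)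
    have hcl : ∀ U ∈ 𝓝 p, (U ∩ {z : (M.space.prodLine T).carrier |
        (z.2 : K) ≠ 0 ∧ z.1 ∈ C (z.2 : K)}).Nonempty := mem_closure_iff_nhds.1 h
    have hfst : ∀ a, (fun z : (M.space.prodLine T).carrier => Φ.ext a (Prod.fst z)) ∈
        (M.space.prodLine T).regAt p := fun a =>
      prodLine_fst_mem_regAt (z := p) (Φ.ext_mem_regAt a y)
    have hrange : ∀ᶠ z : (M.space.prodLine T).carrier in 𝓝 p, Prod.fst z ∈ Set.range Φ.Θ := by
      obtain ⟨D, f, hf, hy, hD⟩ := exists_local_of_mem_nhds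
        (Φ.isOpen_range.mem_nhds (Set.mem_range_self y))
      exact Filter.mem_of_superset ((local_prodLine_fst hf).isOpen.mem_nhds hy) fun z hz => hD hz
    refine ⟨fun a ha => ?_, ?_⟩
    · by_contra hne
      have hne' : (fun z : (M.space.prodLine T).carrier => Φ.ext a (Prod.fst z)) p ≠ 0 := by
        change Φ.ext a (Φ.Θ y) ≠ 0
        rwa [ext_apply]
      obtain ⟨z, ⟨hz1, ⟨z', hz'⟩⟩, hz3, hz4⟩ := hcl _ (Filter.inter_mem
        (eventually_ne_zero (hfst a) hne') hrange)
      rw [← hz'] at hz4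
      refine hz1 ?_
      rw [← hz', ext_apply]
      exact ((Φ.mem_curve _ hz3 z').1 hz4).1 a ha
    · by_contra hne
      have hne' : ((fun z : (M.space.prodLine T).carrier => Φ.ext Φ.tt (Prod.fst z)) -
          fun z : (M.space.prodLine T).carrier => ((Prod.snd z : T) : K)) p ≠ 0 := by
        change Φ.ext Φ.tt (Φ.Θ y) - 0 ≠ 0
        rwa [ext_apply, sub_zero]
      obtain ⟨z, ⟨hz1, ⟨z', hz'⟩⟩, hz3, hz4⟩ := hcl _ (Filter.inter_mem
        (eventually_ne_zero (sub_mem (hfst Φ.tt) (prodLine_snd_mem_regAt p)) hne') hrange)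
      rw [← hz'] at hz4
      refine hz1 ?_
      change Φ.ext Φ.tt z.1 - (z.2 : K) = 0
      rw [← hz', ext_apply, ((Φ.mem_curve _ hz3 z').1 hz4).2, sub_self]
  · rintro ⟨hJ, htt⟩
    let p : (M.space.prodLine T).carrier := ((Φ.Θ y, ⟨0, hT0⟩) : M.space.carrier × T)
    suffices h : ∀ U ∈ 𝓝 p, (U ∩ {z : (M.space.prodLine T).carrier |
        (z.2 : K) ≠ 0 ∧ z.1 ∈ C (z.2 : K)}).Nonempty from
      ⟨hT0, (mem_closure_iff_nhds (x := p)).2 h⟩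
    intro U hU
    let V : Set (Φ.R →ₐ[K] K) := {z | z Φ.tt ∈ T}
    let Ψ : (Φ.R →ₐ[K] K) → (M.space.prodLine T).carrier := fun z =>
      ((Φ.Θ z, if h : z Φ.tt ∈ T then ⟨z Φ.tt, h⟩ else ⟨0, hT0⟩) : M.space.carrier × T)
    have hΨ : Ψ y = p := by
      simp only [Ψ, htt, hT0, dif_pos]
      rfl
    obtain ⟨D, f, hf, hD, hDU⟩ := exists_local_of_mem_nhds hU
    have hyV : y ∈ V := by
      change y Φ.tt ∈ T
      rwa [htt]
    obtain ⟨a, b, hb, H⟩ := hf.exists_fraction Ψ V (by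
      rintro D f (⟨D, f, hf, h⟩ | h) z hz hzD
      · obtain ⟨rfl, rfl⟩ := Prod.mk.inj h
        obtain ⟨a, b, hb, H⟩ := Φ.exists_fraction hf z hzD
        exact ⟨a, b, hb, fun z' _ hz' => H z' hz'⟩
      · obtain ⟨rfl, rfl⟩ := Prod.mk.inj h
        refine ⟨Φ.tt, 1, by simp, fun z' hz' _ => ⟨Set.mem_univ _, ?_⟩⟩
        have : z' Φ.tt ∈ T := hz'
        simp [Ψ, this]) y hyV (by rwa [hΨ])
    let g : Φ.R := b * ∏ s ∈ hT.toFinset, (Φ.tt - algebraMap K Φ.R s)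
    have hg : y g ≠ 0 := by
      simp only [g, map_mul, map_prod, map_sub, htt, AlgHom.commutes]
      refine mul_ne_zero hb (Finset.prod_ne_zero_iff.2 fun s hs => ?_)
      rw [Set.Finite.mem_toFinset] at hs
      simp only [Algebra.algebraMap_self, RingHom.id_apply, zero_sub, neg_ne_zero]
      rintro rfl
      exact hs hT0
    obtain ⟨z, hzJ, hz⟩ : ∃ z : Φ.R →ₐ[K] K, (∀ a ∈ Φ.J, z a = 0) ∧
        z (g * Φ.X 0 * Φ.X 1) ≠ 0 := by
      refine exists_point_of_notMem_radical fun h => hg ?_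
      have h1 := mem_radical_of_mul_mem (Φ.η 1) (Φ.η_J 1) (by simp [Φ.η_X]) h
      obtain ⟨n, hn⟩ := mem_radical_of_mul_mem (Φ.η 0) (Φ.η_J 0) (by simp [Φ.η_X]) h1
      have h2 := hJ _ hn
      rw [map_pow] at h2
      exact eq_zero_of_pow_eq_zero h2
    simp only [g, map_mul, map_prod, map_sub, AlgHom.commutes, mul_ne_zero_iff] at hz
    obtain ⟨⟨⟨hzb, hzT⟩, hz0⟩, hz1⟩ := hz
    have hzV : z Φ.tt ∈ T := by
      by_contra h
      refine Finset.prod_ne_zero_iff.1 hzT (z Φ.tt) ?_ ?_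
      · rw [Set.Finite.mem_toFinset]
        exact h
      · simp
    have hz2 : z Φ.tt ≠ 0 := by
      rw [Ne, Φ.tt_eq_zero z hzJ]
      rintro ⟨i, hi⟩
      fin_cases i
      exacts [hz0 hi, hz1 hi]
    refine ⟨Ψ z, hDU (H z hzV hzb).1, ?_⟩
    simp only [Ψ, hzV, dif_pos]
    exact ⟨hz2, (Φ.mem_curve _ hz2 z).2 ⟨hzJ, rfl⟩⟩

variable (Φ : NodeChart.{u, v} M C)

theorem Tw_subset_centralFiber (hT : Tᶜ.Finite) (hT0 : (0 : K) ∈ T) (b : Fin 2) :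
    Φ.Tw b ⊆ centralFiber C T := by
  by_contra h
  obtain ⟨q, hq, hq'⟩ := Set.not_subset.1 h
  obtain ⟨_, h1, ⟨y, rfl⟩, h3⟩ := (Φ.irred b).2 _ _ Φ.isOpen_range
    (isClosed_centralFiber C hT0).isOpen_compl ⟨_, Φ.pt_mem b, _, rfl⟩ ⟨q, hq, hq'⟩
  refine h3 ((Φ.mem_centralFiber_iff hT hT0).2 ⟨Φ.Tw_J b y h1, ?_⟩)
  exact (Φ.tt_eq_zero y (Φ.Tw_J b y h1)).2 ⟨b, (Φ.isAxis b y h1).1⟩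

theorem Tw_le_iff {b b' : Fin 2} : Φ.Tw b ⊆ Φ.Tw b' ↔ b = b' := by
  refine ⟨fun h => ?_, fun h => by rw [h]⟩
  obtain rfl | rfl := eq_or_eq_add_one b b'
  · rfl
  · obtain ⟨y, hy, hne⟩ := Φ.exists_ne b
    exact absurd (Φ.isAxis _ y (h hy)).1 hne

theorem exists_subset_Tw (hT : Tᶜ.Finite) (hT0 : (0 : K) ∈ T) {Z : Set M.space.carrier}
    (hZ : IsIrreducible Z) (hZC : Z ⊆ centralFiber C T) (hpt : Φ.Θ Φ.pt ∈ Z) :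
    ∃ b, Z ⊆ Φ.Tw b := by
  by_contra! h
  have hopen : ∀ b, IsOpen (Φ.Tw b)ᶜ := fun b => (Φ.axial b).isClosed.isOpen_compl
  obtain ⟨q₀, h0, h0'⟩ := Set.not_subset.1 (h 0)
  obtain ⟨q₁, h1, h1'⟩ := Set.not_subset.1 (h 1)
  obtain ⟨D, f, hf, hD, hDe⟩ := exists_local_of_mem_nhds
    (eventually_of_forall (p := fun q => ∃ z, Φ.Θ z = q ∧ z Φ.e ≠ 0) Φ.pt_e
      fun z hz => ⟨z, rfl, hz⟩)
  obtain ⟨q, hq, hqD, hq0⟩ := hZ.2 _ _ hf.isOpen (hopen 0) ⟨_, hpt, hD⟩ ⟨q₀, h0, h0'⟩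
  obtain ⟨r, hr, ⟨hrD, hr0⟩, hr1⟩ := hZ.2 _ _ (hf.isOpen.inter (hopen 0)) (hopen 1)
    ⟨q, hq, hqD, hq0⟩ ⟨q₁, h1, h1'⟩
  obtain ⟨z, rfl, hze⟩ := hDe hrD
  obtain ⟨hzJ, hzt⟩ := (Φ.mem_centralFiber_iff hT hT0).1 (hZC hr)
  obtain ⟨b, hb⟩ := (Φ.tt_eq_zero z hzJ).1 hzt
  have hmem := (Φ.near z hzJ hze).1 b hb
  fin_cases b
  exacts [hr0 hmem, hr1 hmem]

/-- Exactly two components of the central fibre pass through the origin. -/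
theorem maximal_and_mem_iff (hT : Tᶜ.Finite) (hT0 : (0 : K) ∈ T) {Z : Set M.space.carrier} :
    (Maximal (fun Y => IsIrreducible Y ∧ Y ⊆ centralFiber C T) Z ∧ Φ.Θ Φ.pt ∈ Z) ↔
      ∃ b, Z = Φ.Tw b := by
  constructor
  · rintro ⟨hZ, hpt⟩
    obtain ⟨b, hb⟩ := Φ.exists_subset_Tw hT hT0 hZ.1.1 hZ.1.2 hpt
    exact ⟨b, hb.antisymm (hZ.2 ⟨Φ.irred b, Φ.Tw_subset_centralFiber hT hT0 b⟩ hb)⟩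
  · rintro ⟨b, rfl⟩
    refine ⟨⟨⟨Φ.irred b, Φ.Tw_subset_centralFiber hT hT0 b⟩, fun Y hY hle => ?_⟩, Φ.pt_mem b⟩
    obtain ⟨b', hb'⟩ := Φ.exists_subset_Tw hT hT0 hY.1 hY.2 (hle (Φ.pt_mem b))
    obtain rfl := Φ.Tw_le_iff.1 (hle.trans hb')
    exact hb'

end Twigs

end NodeChart

/-! ### The base of the tower -/

section LocalAlgebra

variable {K : Type u} [Field K] {A : Type v} [CommRing A] [Algebra K A]

theorem finiteType_of_etale (x : Fin 2 → A)
    (hx : (MvPolynomial.aeval x : MvPolynomial (Fin 2) K →ₐ[K] A).toRingHom.Etale) :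
    Algebra.FiniteType K A := by
  let _ : Algebra (MvPolynomial (Fin 2) K) A :=
    (MvPolynomial.aeval x : MvPolynomial (Fin 2) K →ₐ[K] A).toRingHom.toAlgebra
  have : IsScalarTower K (MvPolynomial (Fin 2) K) A := IsScalarTower.of_algebraMap_eq'
    (AlgHom.comp_algebraMap (MvPolynomial.aeval x : MvPolynomial (Fin 2) K →ₐ[K] A)).symm
  have : Algebra.Etale (MvPolynomial (Fin 2) K) A := hx
  exact Algebra.FiniteType.trans (S := MvPolynomial (Fin 2) K) inferInstance inferInstance

theorem exists_smul_mem_of_le_sup [IsNoetherianRing A] (o : A →ₐ[K] K) {I J : Ideal A}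
    (h : J ≤ I ⊔ RingHom.ker o • J) : ∃ e : A, o e ≠ 0 ∧ ∀ a ∈ J, e * a ∈ I := by
  obtain ⟨r, hr, hrJ⟩ := Submodule.exists_sub_one_mem_and_smul_le_of_fg_of_le_sup
    (IsNoetherian.noetherian J) le_rfl h
  refine ⟨r, ?_, fun a ha => hrJ (Submodule.smul_mem_pointwise_smul _ _ _ ha)⟩
  rw [RingHom.mem_ker, map_sub, map_one, sub_eq_zero] at hr
  rw [hr]
  exact one_ne_zero

/-- If all tangent vectors at a point which kill the `x b` vanish, then the `x b` generate
the maximal ideal of this point in a neighbourhood. -/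
theorem exists_mul_mem_span_range [IsNoetherianRing A] (o : A →ₐ[K] K) {x : Fin 2 → A}
    (ho : ∀ b, o (x b) = 0)
    (hd : ∀ d : A →ₗ[K] K, (∀ a b, d (a * b) = o a * d b + o b * d a) → (∀ b, d (x b) = 0) →
      ∀ a, d a = 0) :
    ∃ e : A, o e ≠ 0 ∧ ∀ a, o a = 0 → e * a ∈ Ideal.span (Set.range x) := by
  refine exists_smul_mem_of_le_sup o (J := RingHom.ker o) fun a ha => ?_
  by_contra hna
  let N : Ideal A := Ideal.span (Set.range x) ⊔ RingHom.ker o • RingHom.ker o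
  obtain ⟨φ, hφa, hφ⟩ := Submodule.exists_dual_map_eq_bot_of_notMem
    (p := N.restrictScalars K) (x := a) hna inferInstance
  have hφN : ∀ b ∈ N, φ b = 0 := fun b hb =>
    (Submodule.mem_bot K).1 (hφ ▸ Submodule.mem_map_of_mem (p := N.restrictScalars K) hb)
  let d : A →ₗ[K] K := φ - φ 1 • o.toLinearMap
  have hd' : ∀ b, d b = φ b - φ 1 * o b := fun b => rfl
  refine hφa ?_
  have := hd d (fun b c => ?_) (fun b => ?_) a
  · rwa [hd', show o a = 0 from ha, mul_zero, sub_zero] at this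
  · have h := hφN ((b - algebraMap K A (o b)) * (c - algebraMap K A (o c)))
      (Ideal.mem_sup_right (Ideal.mul_mem_mul (by simp [RingHom.mem_ker])
        (by simp [RingHom.mem_ker])))
    have h' : (b - algebraMap K A (o b)) * (c - algebraMap K A (o c)) =
        b * c - o b • c - o c • b + (o b * o c) • 1 := by
      simp only [Algebra.smul_def, map_mul]
      ring
    rw [h', map_add, map_sub, map_sub, map_smul, map_smul, map_smul] at h
    simp only [hd', map_mul, smul_eq_mul] at h ⊢
    linear_combination h
  · rw [hd', ho, mul_zero, sub_zero]
    exact hφN _ (Ideal.mem_sup_left (Ideal.subset_span ⟨b, rfl⟩))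

theorem exists_mul_mem_span_singleton [IsNoetherianRing A] (o : A →ₐ[K] K) {x : Fin 2 → A}
    (ho : ∀ b, o (x b) = 0) {e : A} (he : o e ≠ 0)
    (hex : ∀ a, o a = 0 → e * a ∈ Ideal.span (Set.range x)) {P : Ideal A} [P.IsPrime]
    (hPo : P ≤ RingHom.ker o) {b : Fin 2} (hb : x b ∈ P) (hb' : x (b + 1) ∉ P) :
    ∃ s : A, o s ≠ 0 ∧ ∀ a ∈ P, s * a ∈ Ideal.span {x b} := by
  refine exists_smul_mem_of_le_sup o fun f hf => ?_
  have h := hex f (hPo hf)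
  have hrange : Set.range x = {x b, x (b + 1)} := by
    ext a
    constructor
    · rintro ⟨c, rfl⟩
      obtain rfl | rfl := eq_or_eq_add_one b c
      exacts [Or.inl rfl, Or.inr rfl]
    · rintro (rfl | rfl)
      exacts [⟨_, rfl⟩, ⟨_, rfl⟩]
  rw [hrange, Ideal.mem_span_pair] at h
  obtain ⟨p, q, hpq⟩ := h
  have hq : q ∈ P := by
    have : q * x (b + 1) ∈ P := by
      rw [show q * x (b + 1) = e * f - p * x b by rw [← hpq]; ring]
      exact P.sub_mem (P.mul_mem_left _ hf) (P.mul_mem_left _ hb)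
    exact (Ideal.IsPrime.mem_or_mem inferInstance this).resolve_right hb'
  let c : A := algebraMap K A (o e)⁻¹
  have hf' : f = c * p * x b + (x (b + 1) * (c * q) + (1 - c * e) * f) := by
    linear_combination -c * hpq
  rw [hf']
  refine Submodule.add_mem_sup (Ideal.mul_mem_left _ _ (Ideal.mem_span_singleton_self _))
    (Submodule.add_mem _ (Submodule.smul_mem_smul (ho _) (P.mul_mem_left _ hq))
      (Submodule.smul_mem_smul ?_ hf))
  rw [RingHom.mem_ker, map_sub, map_mul, map_one]
  simp [c, he]

end LocalAlgebra

section Base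

variable {K : Type u} [Field K] {A : Type v} [CommRing A] [Algebra K A]

theorem local_affine (a : A) : (affine K A).Local Set.univ fun y : A →ₐ[K] K => y a :=
  Local.gen ⟨a, rfl⟩

/-- A homomorphism as a point of the affine variety. -/
def affinePt (y : A →ₐ[K] K) : (affine K A).carrier := y

theorem affinePt_injective : Function.Injective (affinePt (K := K) (A := A)) := fun _ _ h => h

theorem range_affinePt : Set.range (affinePt (K := K) (A := A)) = Set.univ :=
  Set.eq_univ_of_forall fun y => ⟨y, rfl⟩

theorem exists_affinePt (q : (affine K A).carrier) : ∃ y : A →ₐ[K] K, affinePt y = q := ⟨q, rfl⟩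

variable (K) in
/-- The set of `K`-points at which an ideal vanishes. -/
def zeroSet (I : Ideal A) : Set (affine K A).carrier :=
  affinePt '' {y : A →ₐ[K] K | ∀ a ∈ I, y a = 0}

theorem affinePt_mem_zeroSet {I : Ideal A} {y : A →ₐ[K] K} :
    affinePt y ∈ zeroSet K I ↔ ∀ a ∈ I, y a = 0 := affinePt_injective.mem_set_image

theorem isClosed_zeroSet (I : Ideal A) : IsClosed (zeroSet K I) := by
  have h : zeroSet K I = ⋂ a ∈ I, {q : (affine K A).carrier | (show A →ₐ[K] K from q) a ≠ 0}ᶜ := by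
    ext q
    obtain ⟨y, rfl⟩ := exists_affinePt q
    rw [affinePt_mem_zeroSet, Set.mem_iInter₂]
    exact forall₂_congr fun a _ => not_not.symm
  rw [h]
  refine isClosed_biInter fun a _ => IsOpen.isClosed_compl ?_
  have := (local_affine (K := K) a).inv.isOpen
  rwa [Set.univ_inter] at this

theorem zeroSet_ker (o : A →ₐ[K] K) : zeroSet K (RingHom.ker o) = {affinePt o} := by
  ext q
  obtain ⟨y, rfl⟩ := exists_affinePt q
  rw [affinePt_mem_zeroSet, Set.mem_singleton_iff, affinePt_injective.eq_iff]
  refine ⟨fun h => AlgHom.ext fun a => ?_, ?_⟩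
  · have h1 := h (a - algebraMap K A (o a)) (by simp [RingHom.mem_ker])
    rw [map_sub, AlgHom.commutes] at h1
    exact sub_eq_zero.1 h1
  · rintro rfl
    exact fun a ha => ha

variable (K A) in
/-- The tautological chart of an affine variety. -/
abbrev affineChart [Algebra.FiniteType K A] : AffineChart.{u, v} (affine K A) where
  R := A
  Θ := affinePt
  injective := affinePt_injective
  isOpen_range := by
    rw [range_affinePt]
    exact isOpen_univ
  ext_mem a y := by
    refine regAt_congr ((local_affine (K := K) a).mem_regAt (Set.mem_univ _))
      (Filter.Eventually.of_forall fun q => ?_)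
    obtain ⟨z, rfl⟩ := exists_affinePt q
    exact ((affinePt_injective (K := K)).extend_apply (fun z => z a) _ z).symm
  exists_fraction h y hy := by
    obtain ⟨a, b, hb, H⟩ := h.exists_fraction affinePt Set.univ (by
      rintro D f ⟨a, h⟩ y _ _
      obtain ⟨rfl, rfl⟩ := Prod.mk.inj h
      exact ⟨a, 1, by simp, fun z _ _ => ⟨Set.mem_univ _, by simp [affinePt]⟩⟩) y
        (Set.mem_univ _) hy
    exact ⟨a, b, hb, fun z => H z (Set.mem_univ _)⟩

variable [IsAlgClosed K] [CharZero K] [Algebra.FiniteType K A]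

theorem isIrreducible_zeroSet {P : Ideal A} [hP : P.IsPrime] {o : A →ₐ[K] K}
    (ho : ∀ a ∈ P, o a = 0) : IsIrreducible (zeroSet K P) := by
  refine ⟨⟨_, affinePt_mem_zeroSet.2 ho⟩, (affineChart K A).isPreirreducible_image ?_⟩
  rintro b b' ⟨z, hz, hzb⟩ ⟨z', hz', hzb'⟩
  obtain ⟨y, hy, hyb⟩ := exists_point_of_notMem_radical (K := K) (I := P) (f := b * b') (by
    rw [hP.isRadical.radical]
    intro h
    rcases hP.mem_or_mem h with h | h
    exacts [hzb (hz _ h), hzb' (hz' _ h)])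
  rw [map_mul, mul_ne_zero_iff] at hyb
  exact ⟨y, hy, hyb⟩

/-- The chart of the base given by étale coordinates. -/
abbrev baseChart (x : Fin 2 → A) (δ : Fin 2 → Derivation K A A)
    (hδ : ∀ a b, δ a (x b) = if a = b then 1 else 0)
    (hd : ∀ (y : A →ₐ[K] K) (d : A →ₗ[K] K), (∀ a b, d (a * b) = y a * d b + y b * d a) →
      ∀ a, d a = ∑ b, d (x b) * y (δ b a)) : Chart.{u, v} (tower K A 0) where
  toAffineChart := affineChart K A
  X := x
  δ := δ
  δ_X := hδ
  B_le _ := le_rfl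
  mem_B_iff' y w hw := ⟨fun _ => hd y (w.comp ((affineChart K A).reg y)) fun a b => pull_mul hw a b,
    fun _ => hw⟩

theorem baseChart_isAxis (x : Fin 2 → A) (δ : Fin 2 → Derivation K A A)
    (hδ : ∀ a b, δ a (x b) = if a = b then 1 else 0)
    (hd : ∀ (y : A →ₐ[K] K) (d : A →ₗ[K] K), (∀ a b, d (a * b) = y a * d b + y b * d a) →
      ∀ a, d a = ∑ b, d (x b) * y (δ b a)) {b : Fin 2} {P : Ideal A} (hb : x b ∈ P)
    (hP : ∀ a ∈ P, δ (b + 1) a ∈ P) : (baseChart x δ hδ hd).IsAxis (zeroSet K P) b := by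
  intro y hy
  have hyP := affinePt_mem_zeroSet.1 hy
  refine ⟨hyP _ hb, fun w => ⟨fun hw => ⟨hw.1, ?_⟩, ?_⟩⟩
  · exact (mem_tangentTo_iff hy hw.1).1 hw (x b) 1 (by simp)
      fun z hz _ => affinePt_mem_zeroSet.1 hz _ hb
  · rintro ⟨hw, h0⟩
    refine (mem_tangentTo_iff hy hw).2 fun a c hc h => ?_
    have h1 := (Chart.mem_B_iff (Φ := baseChart x δ hδ hd) hw).1 hw a
    rw [sum_fin_two' b, h0, zero_mul, zero_add] at h1
    refine h1.trans (mul_eq_zero_of_right _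
      (derivation_apply_eq_zero (δ (b + 1)) hP hyP hc fun z hz => ?_))
    exact h z (affinePt_mem_zeroSet.2 hz)

theorem exists_base_nodeChart (x : Fin 2 → A)
    (hx : (MvPolynomial.aeval x : MvPolynomial (Fin 2) K →ₐ[K] A).toRingHom.Etale)
    (o : A →ₐ[K] K) (ho : ∀ i, o (x i) = 0) :
    ∃ Φ : NodeChart.{u, v} (tower K A 0) (fun t => X x t 0),
      (∀ q, q ∈ Set.range Φ.Θ) ∧ (∀ i q, Φ.ext (Φ.X i) q = coord x 0 Fin.elim0 i q) ∧
        ∀ q, IsNode x o 0 Fin.elim0 q ↔ q = Φ.Θ Φ.pt := by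
  have : IsNoetherianRing A := Algebra.FiniteType.isNoetherianRing K A
  obtain ⟨δ, hδ, hd⟩ := exists_dual_derivations x hx
  obtain ⟨e₀, he₀, he⟩ := exists_mul_mem_span_range o ho fun d hdl h a => by
    rw [hd o d hdl]
    simp [h]
  have hδ0 : ∀ b, δ (b + 1) (x b) = 0 := fun b => by rw [hδ, if_neg (add_one_ne b)]
  have hker : (RingHom.ker o).IsPrime := RingHom.ker_isPrime o
  choose P hP hPo using fun b => Ideal.exists_minimalPrimes_le (I := Ideal.span {x b})
    (J := RingHom.ker o) (by
      rw [Ideal.span_singleton_le_iff_mem]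
      exact ho b)
  have hprime : ∀ b, (P b).IsPrime := fun b => (hP b).1.1
  have hxP : ∀ b, x b ∈ P b := fun b => (hP b).1.2 (Ideal.mem_span_singleton_self _)
  have hδP : ∀ b, ∀ a ∈ P b, δ (b + 1) a ∈ P b := fun b a ha =>
    derivation_mem_minimalPrime _ (fun c hc => by
      obtain ⟨c, rfl⟩ := Ideal.mem_span_singleton'.1 hc
      rw [Derivation.leibniz, hδ0, smul_zero, zero_add, smul_eq_mul]
      exact Ideal.mul_mem_right _ _ (Ideal.mem_span_singleton_self _)) (hP b) ha
  have hxP' : ∀ b, x (b + 1) ∉ P b := fun b h => by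
    have h1 := hδP b _ h
    rw [hδ, if_pos rfl] at h1
    exact (hprime b).ne_top ((Ideal.eq_top_iff_one _).2 h1)
  choose s hs hsP using fun b => exists_mul_mem_span_singleton o ho he₀ he (hPo b) (hxP b) (hxP' b)
  let Φ := baseChart x δ hδ hd
  have haxis : ∀ b, Φ.IsAxis (zeroSet K (P b)) b := fun b =>
    baseChart_isAxis x δ hδ hd (hxP b) (hδP b)
  let Ψ : NodeChart.{u, v} (tower K A 0) (fun t => X x t 0) :=
    { toChart := Φ
      wt := ![1, -1]
      wt_pos := one_pos
      wt_neg := by simp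
      J := ⊥
      tt := x 0 * x 1
      η := δ
      η_X := hδ
      η_J := fun b a ha => by
        rw [Ideal.mem_bot] at ha ⊢
        rw [ha, map_zero]
      euler_J := fun a ha => by
        rw [Ideal.mem_bot] at ha ⊢
        rw [ha, map_zero]
      euler_tt := by
        rw [Ideal.mem_bot, Derivation.leibniz]
        have h0 : Φ.euler ![1, -1] (x 0) = x 0 := (Φ.euler_X _ 0).trans (by simp [Φ])
        have h1 : Φ.euler ![1, -1] (x 1) = -x 1 := (Φ.euler_X _ 1).trans (by simp [Φ])
        rw [h0, h1, smul_eq_mul, smul_eq_mul]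
        ring
      unram := fun y _ hy d hdl _ hdt => by
        rw [map_mul, mul_ne_zero_iff] at hy
        rw [hdl] at hdt
        have hy0 := hy.1
        refine ⟨d (x 0) / y (x 0), fun a => ?_⟩
        have h : Φ.euler ![1, -1] a = x 0 * δ 0 a - x 1 * δ 1 a :=
          (Φ.euler_apply _ 0 a).trans (by simp [Φ, sub_eq_add_neg])
        rw [h, hd y d hdl a, Fin.sum_univ_two, map_sub, map_mul, map_mul]
        field_simp
        linear_combination y (δ 1 a) * hdt
      tt_eq_zero := fun y _ => by
        rw [map_mul, mul_eq_zero, Fin.exists_fin_two]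
      mem_curve := fun t _ y => by
        refine Iff.trans (b := y (x 0) * y (x 1) = t) Iff.rfl ?_
        rw [map_mul]
        exact ⟨fun h => ⟨fun a ha => by rw [(Ideal.mem_bot).1 ha, map_zero], h⟩, fun h => h.2⟩
      pt := o
      pt_X := ho
      pt_J := fun a ha => by rw [(Ideal.mem_bot).1 ha, map_zero]
      isClosed_pt := by
        have := isClosed_zeroSet (K := K) (RingHom.ker o)
        rwa [zeroSet_ker] at this
      Tw := fun b => zeroSet K (P b)
      axial := fun b =>
        { isClosed := isClosed_zeroSet _
          exists_chart := fun q _ => ⟨Φ, b + 1, exists_affinePt q, by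
            rw [add_one_add_one]
            exact haxis b⟩ }
      irred := fun b => isIrreducible_zeroSet (hPo b)
      isAxis := haxis
      Tw_J := fun b y _ a ha => by rw [(Ideal.mem_bot).1 ha, map_zero]
      pt_mem := fun b => affinePt_mem_zeroSet.2 (hPo b)
      exists_ne := fun b => by
        obtain ⟨y, hy, hne⟩ := exists_point_of_notMem_radical (K := K) (I := P b)
          (f := x (b + 1)) (by rw [(hprime b).isRadical.radical]; exact hxP' b)
        exact ⟨y, affinePt_mem_zeroSet.2 hy, hne⟩
      e := e₀ * (s 0 * s 1)
      pt_e := by simp [he₀, hs]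
      near := fun y _ hy => by
        have hy' : y e₀ ≠ 0 ∧ ∀ b, y (s b) ≠ 0 := by
          simpa [Fin.forall_fin_two] using hy
        refine ⟨fun b hb => affinePt_mem_zeroSet.2 fun a ha => ?_, fun h => ?_⟩
        · obtain ⟨c, hc⟩ := Ideal.mem_span_singleton'.1 (hsP b a ha)
          have := congrArg y hc
          rw [map_mul, map_mul, show y (x b) = 0 from hb, mul_zero, eq_comm, mul_eq_zero] at this
          exact this.resolve_left (hy'.2 b)
        · have h1 : affinePt y ∈ zeroSet K (RingHom.ker o) := affinePt_mem_zeroSet.2 fun a ha => by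
            have h2 : Ideal.span (Set.range x) ≤ RingHom.ker y := by
              rw [Ideal.span_le]
              rintro _ ⟨b, rfl⟩
              exact h b
            have h3 := h2 (he a ha)
            rw [RingHom.mem_ker, map_mul, mul_eq_zero] at h3
            exact h3.resolve_left hy'.1
          rw [zeroSet_ker] at h1
          exact affinePt_injective h1 }
  exact ⟨Ψ, exists_affinePt, fun i q => Ψ.ext_apply _ q, fun q => Iff.rfl⟩

end Base

/-! ### The charts of the tower -/

section Tower

variable {K : Type u} [Field K] {A : Type v} [CommRing A] [Algebra K A]

/-- The chart `Φ` is the chart of the monster tower with a given word, and its origin is the node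
over `o`. -/
structure NodeChart.Represents {k : ℕ} {x : Fin 2 → A}
    (Φ : NodeChart.{u, v} (tower K A k) (fun t => X x t k)) (o : A →ₐ[K] K) (p : Fin k → Fin 2) :
    Prop where
  mem_range_iff : ∀ q, q ∈ Set.range Φ.Θ ↔ q ∈ chart x k p
  coord_eq : ∀ i y, coord x k p i (Φ.Θ y) = y (Φ.X i)
  isNode_iff : ∀ q, IsNode x o k p q ↔ q = Φ.Θ Φ.pt

variable [IsAlgClosed K] [CharZero K]

/-- The next chart of a chart of the monster tower. -/
abbrev NodeChart.nextTower {k : ℕ} {x : Fin 2 → A}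
    (Φ : NodeChart.{u, v} (tower K A k) (fun t => X x t k)) (j : Fin 2) :
    NodeChart.{u, v} (tower K A (k + 1)) (fun t => X x t (k + 1)) :=
  Φ.next j

namespace NodeChart.Represents

variable {k : ℕ} {x : Fin 2 → A} {o : A →ₐ[K] K} {p : Fin (k + 1) → Fin 2}
  {Φ : NodeChart.{u, v} (tower K A k) (fun t => X x t k)}

theorem eventually_coord_eq {p : Fin k → Fin 2} (h : Φ.Represents o p) (i : Fin 2)
    (y : Φ.R →ₐ[K] K) : ∀ᶠ q in 𝓝 (Φ.Θ y), Φ.ext (Φ.X i) q = coord x k p i q := by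
  filter_upwards [Φ.isOpen_range.mem_nhds ⟨y, rfl⟩]
  rintro _ ⟨z, rfl⟩
  rw [h.coord_eq, ext_apply]

theorem dirDeriv_coord {p : Fin k → Fin 2} (h : Φ.Represents o p) (i : Fin 2)
    {q : (tower K A k).Points} (hq : q.1 ∈ Set.range Φ.Θ) :
    dirDeriv ((tower K A k).dir q) (coord x k p i) =
      dirDeriv ((tower K A k).dir q) (Φ.ext (Φ.X i)) := by
  obtain ⟨y, hy⟩ := hq
  refine (dirDeriv_congr (Φ.B_le _ ((tower K A k).dir_mem q)) ?_ ?_).symm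
  · rw [← hy]
    exact Φ.ext_mem_regAt _ y
  · rw [← hy]
    exact h.eventually_coord_eq i y

theorem mem_range_next_iff (h : Φ.Represents o (Fin.init p)) (q : (S K A (k + 1)).carrier) :
    q ∈ Set.range (Φ.nextTower (p (Fin.last k))).Θ ↔ q ∈ chart x (k + 1) p := by
  refine Φ.mem_range_nextΘ.trans ?_
  refine Iff.trans ?_ (and_congr_left' (h.mem_range_iff (π k q)))
  refine and_congr_right fun hq => ?_
  rw [h.dirDeriv_coord _ hq]

theorem coord_next (h : Φ.Represents o (Fin.init p)) (i : Fin 2) (z : Polynomial Φ.R →ₐ[K] K) :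
    coord x (k + 1) p i ((Φ.nextTower (p (Fin.last k))).Θ z) = z (Φ.nextX (p (Fin.last k)) i) := by
  obtain rfl | rfl := eq_or_eq_add_one (p (Fin.last k)) i
  · refine (congrFun (if_pos rfl) _).trans ?_
    rw [Chart.nextX_self, apply_C]
    exact h.coord_eq _ _
  · refine (congrFun (if_neg (add_one_ne _)) _).trans ?_
    rw [Chart.nextX_add_one]
    refine Eq.trans ?_ (Φ.slope_nextΘ (j := p (Fin.last k)) z)
    exact congrArg₂ _ (h.dirDeriv_coord _ ⟨_, rfl⟩) (h.dirDeriv_coord _ ⟨_, rfl⟩)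

theorem next (h : Φ.Represents o (Fin.init p)) :
    (Φ.nextTower (p (Fin.last k))).Represents o p where
  mem_range_iff := h.mem_range_next_iff
  coord_eq := h.coord_next
  isNode_iff q := by
    rw [IsNode, h.isNode_iff, ← h.mem_range_next_iff]
    constructor
    · rintro ⟨h1, ⟨z, rfl⟩, h2⟩
      have h3 : basePt z = Φ.pt := Φ.injective h1
      have h4 := h2 (p (Fin.last k) + 1)
      rw [h.coord_next, Chart.nextX_add_one] at h4
      refine congrArg _ ?_
      change z = extPt Φ.pt 0
      rw [← h3, ← h4, extPt_basePt]
    · rintro rfl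
      refine ⟨congrArg Φ.Θ (basePt_extPt _ _), ⟨_, rfl⟩, fun i => ?_⟩
      rw [h.coord_next]
      exact (Φ.nextTower (p (Fin.last k))).pt_X i

end NodeChart.Represents

theorem exists_nodeChart (x : Fin 2 → A)
    (hx : (MvPolynomial.aeval x : MvPolynomial (Fin 2) K →ₐ[K] A).toRingHom.Etale)
    (o : A →ₐ[K] K) (ho : ∀ i, o (x i) = 0) : ∀ (k : ℕ) (p : Fin k → Fin 2),
    ∃ Φ : NodeChart.{u, v} (tower K A k) (fun t => X x t k), Φ.Represents o p
  | 0, _ => by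
    have := finiteType_of_etale x hx
    obtain ⟨Φ, h1, h2, h3⟩ := exists_base_nodeChart x hx o ho
    exact ⟨Φ, fun q => iff_of_true (h1 q) trivial, fun i y => (h2 i _).symm.trans (ext_apply _ _ _),
      h3⟩
  | k + 1, p => by
    obtain ⟨Φ, h⟩ := exists_nodeChart x hx o ho k (Fin.init p)
    exact ⟨_, h.next⟩

theorem image_π_fiber {k : ℕ} {x : Fin 2 → A}
    (Φ : NodeChart.{u, v} (tower K A k) (fun t => X x t k)) (j : Fin 2) :
    π k '' (Φ.nextTower j).Tw j = {Φ.Θ Φ.pt} := by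
  have h : (Φ.nextTower j).Tw j = (tower K A k).fst ⁻¹' {Φ.Θ Φ.pt} := Φ.nextTw_self j
  refine Set.eq_singleton_iff_unique_mem.2 ⟨⟨_, (Φ.nextTower j).pt_mem j, ?_⟩, ?_⟩
  · exact congrArg Φ.Θ (basePt_extPt _ _)
  · rintro _ ⟨q, hq, rfl⟩
    rw [h] at hq
    exact hq

end Tower

end Monster

end

theorem theorem4p2 {K : Type u} [Field K] [IsAlgClosed K] [CharZero K]
    {A : Type v} [CommRing A] [Algebra K A] (x : Fin 2 → A)
    (hx : (MvPolynomial.aeval x : MvPolynomial (Fin 2) K →ₐ[K] A).toRingHom.Etale)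
    (o : A →ₐ[K] K) (ho : ∀ i, o (x i) = 0)
    (T : Set K) (hT : Tᶜ.Finite) (hT0 : (0 : K) ∈ T)
    (k : ℕ) (p : Fin (k + 1) → Fin 2) :
    ∃ (N : (Monster.S K A (k + 1)).carrier) (N' : (Monster.S K A k).carrier),
      (∀ q, Monster.IsNode x o (k + 1) p q ↔ q = N) ∧
      (∀ q, Monster.IsNode x o k (Fin.init p) q ↔ q = N') ∧
      ∃ E R : Set (Monster.S K A (k + 1)).carrier,
        E ≠ R ∧
        (∀ Z, (Monster.IsTwig x T (k + 1) Z ∧ N ∈ Z) ↔ (Z = E ∨ Z = R)) ∧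
        Monster.π k '' E = {N'} ∧
        Monster.IsTwig x T k (Monster.π k '' R) ∧
        Monster.FunSpace.IsIsomorphismOn (Monster.π k) R (Monster.π k '' R) := by
  obtain ⟨Φ, h⟩ := Monster.exists_nodeChart x hx o ho k (Fin.init p)
  let j := p (Fin.last k)
  let Ψ := Φ.nextTower j
  have hR : Ψ.Tw (j + 1) = (Monster.tower K A k).tangentLift (Φ.Tw (j + 1)) := Φ.nextTw_add_one j
  have hπR : Monster.π k '' Ψ.Tw (j + 1) = Φ.Tw (j + 1) :=
    (congrArg _ hR).trans (Φ.axial (j + 1)).image_tangentLift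
  refine ⟨Ψ.Θ Ψ.pt, Φ.Θ Φ.pt, h.next.isNode_iff, h.isNode_iff, Ψ.Tw j, Ψ.Tw (j + 1), ?_, ?_,
    Monster.image_π_fiber Φ j, ?_, ?_⟩
  · intro he
    exact Monster.add_one_ne j (Ψ.Tw_le_iff.1 he.le).symm
  · refine fun Z => (Ψ.maximal_and_mem_iff hT hT0).trans ⟨?_, ?_⟩
    · rintro ⟨b, rfl⟩
      obtain rfl | rfl := Monster.eq_or_eq_add_one j b
      exacts [Or.inl rfl, Or.inr rfl]
    · rintro (rfl | rfl)
      exacts [⟨_, rfl⟩, ⟨_, rfl⟩]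
  · rw [hπR]
    exact ((Φ.maximal_and_mem_iff hT hT0).2 ⟨_, rfl⟩).1
  · rw [hπR, hR]
    exact (Φ.axial (j + 1)).isIsomorphismOn (Φ.irred (j + 1)).1
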